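/- Let $R>0$, $\lambda>0$ and $\theta_0\in\mathbb{R}$. Let $\mathbb{T}$ be the open Margulis tube of radius $R$, core length $\lambda$ and twist parameter $\theta_0$: in cylindrical coordinates $(r,\theta,z)$, with $0\le r<R$, $\theta\in\mathbb{R}/2\pi\mathbb{Z}$ and $z\in\mathbb{R}$, it is the solid cylinder (the points with $r=0$ forming the core line) with the hyperbolic metric $$g=dr^2+\sinh^2 r\,d\theta^2+\cosh^2 r\,dz^2,$$ modulo the identification $(r,\theta,z+\lambda)\sim(r,\theta+\theta_0,z)$. Let $f:\mathbb{T}\to\mathbb{R}$ be a harmonic function, i.e. $f$ is $C^2$ on all of $\mathbb{T}$ (including the core) and its Laplacian with respect to $g$ vanishes. Then there are real numbers $a_{km},a'_{km}$ ($k\in\mathbb{Z}_{\ge 0}$, $m\in\mathbb{Z}$) such that for all $(r,\theta,z)$ with $0\le r<R$ $$f(r,\theta,z)=\sum_{k=0}^{\infty}\sum_{m\in\mathbb{Z}} \tanh^k r\;{}_2F_1\!\left(\tfrac{k}{2}+i\left(\tfrac{m\pi}{\lambda}+\tfrac{k\theta_0}{2\lambda}\right),\tfrac{k}{2}-i\left(\tfrac{m\pi}{\lambda}+\tfrac{k\theta_0}{2\lambda}\right);1+k;\tanh^2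 r\right)\left(a_{km}\sin\left(k\theta+\tfrac{2\pi m}{\lambda}z+\tfrac{k\theta_0}{\lambda}z\right)+a'_{km}\cos\left(k\theta+\tfrac{2\pi m}{\lambda}z+\tfrac{k\theta_0}{\lambda}z\right)\right),$$ where the series converges absolutely at every point, and locally uniformly (as an unordered double series) in $(r,\theta,z)\in[0,R)\times\mathbb{R}\times\mathbb{R}$. -/

import Mathlib

/-- The `i`-th partial derivative of a real function on `ℝⁿ`. -/
noncomputable def partialD {n : ℕ} (i : Fin n) (u : (Fin n → ℝ) → ℝ) (x : Fin n → ℝ) : ℝ :=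
  fderiv ℝ u x (Pi.single i 1)

/-- The Laplace–Beltrami operator in a coordinate chart of a Riemannian metric `g` (given by its
Gram matrix): `Δ u = (det g)^(-1/2) ∑ᵢ ∂ᵢ ((det g)^(1/2) ∑ⱼ gⁱʲ ∂ⱼ u)`. -/
noncomputable def laplaceBeltrami {n : ℕ} (g : (Fin n → ℝ) → Matrix (Fin n) (Fin n) ℝ)
    (u : (Fin n → ℝ) → ℝ) (x : Fin n → ℝ) : ℝ :=
  (Real.sqrt (g x).det)⁻¹ *
    ∑ i, partialD i (fun y => Real.sqrt (g y).det * ∑ j, (g y)⁻¹ i j * partialD j u y) x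

/-- The point with cylindrical coordinates `(r, θ, z)` around a geodesic of hyperbolic
`3`-space (`r` the distance to the geodesic, `θ` the angle, `z` the arc length along the geodesic),
in the global smooth chart `(x, y, z)` with `x = sinh r cos θ`, `y = sinh r sin θ`. -/
noncomputable def cylPoint (r θ z : ℝ) : Fin 3 → ℝ :=
  ![Real.sinh r * Real.cos θ, Real.sinh r * Real.sin θ, z]

/-- The hyperbolic metric `dr² + sinh² r dθ² + cosh² r dz²` in the chart `(x, y, z)` of `cylPoint`.
With `s² = x² + y² = sinh² r` it reads
`dx² + dy² - (x dx + y dy)² / (1 + s²) + (1 + s²) dz²`; in particular it is smooth at the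
geodesic `x = y = 0`. See `tubeMetric_cylPoint`. -/
noncomputable def tubeMetric (p : Fin 3 → ℝ) : Matrix (Fin 3) (Fin 3) ℝ :=
  let w : ℝ := 1 + p 0 ^ 2 + p 1 ^ 2
  !![1 - p 0 ^ 2 / w, -(p 0 * p 1) / w, 0;
     -(p 0 * p 1) / w, 1 - p 1 ^ 2 / w, 0;
     0, 0, w]

/-- The Jacobian matrix of `(r, θ, z) ↦ cylPoint r θ z`; its columns are the derivatives in
`r`, `θ` and `z`. -/
noncomputable def cylJacobian (r θ : ℝ) : Matrix (Fin 3) (Fin 3) ℝ :=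
  !![Real.cosh r * Real.cos θ, -(Real.sinh r * Real.sin θ), 0;
     Real.cosh r * Real.sin θ, Real.sinh r * Real.cos θ, 0;
     0, 0, 1]

/-- In cylindrical coordinates `tubeMetric` is `dr² + sinh² r dθ² + cosh² r dz²`. -/
theorem tubeMetric_cylPoint (r θ z : ℝ) :
    (cylJacobian r θ).transpose * tubeMetric (cylPoint r θ z) * cylJacobian r θ =
      Matrix.diagonal ![1, Real.sinh r ^ 2, Real.cosh r ^ 2] := by
  have hw : 1 + (Real.sinh r * Real.cos θ) ^ 2 + (Real.sinh r * Real.sin θ) ^ 2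
      = Real.cosh r ^ 2 := by
    rw [Real.cosh_sq]
    linear_combination (Real.sinh r ^ 2) * Real.sin_sq_add_cos_sq θ
  have hc : Real.cosh r ≠ 0 := (Real.cosh_pos r).ne'
  have h1 : Real.cos θ ^ 2 = 1 - Real.sin θ ^ 2 := by
    linear_combination Real.sin_sq_add_cos_sq θ
  have h2 : Real.cosh r ^ 2 = 1 + Real.sinh r ^ 2 := by rw [Real.cosh_sq]; ring
  ext i j
  fin_cases i <;> fin_cases j <;>
    simp [Matrix.mul_apply, Fin.sum_univ_three, tubeMetric, cylJacobian, cylPoint, hw] <;>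
    field_simp <;> grind

/-- The open solid cylinder `r < R` around the geodesic, in the chart of `cylPoint`; it is the
universal cover of the open tube of radius `R`. -/
def tubeCover (R : ℝ) : Set (Fin 3 → ℝ) :=
  {p | p 0 ^ 2 + p 1 ^ 2 < Real.sinh R ^ 2}

/-- The `n`-th power of the screw motion (loxodromic isometry) `(r, θ, z) ↦ (r, θ - θ₀, z + ℓ)`. -/
noncomputable def tubeDeck (ℓ θ₀ : ℝ) (n : ℤ) (p : Fin 3 → ℝ) : Fin 3 → ℝ :=
  ![Real.cos (n * θ₀) * p 0 + Real.sin (n * θ₀) * p 1,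
    -Real.sin (n * θ₀) * p 0 + Real.cos (n * θ₀) * p 1,
    p 2 + n * ℓ]

theorem tubeDeck_cylPoint (ℓ θ₀ r θ z : ℝ) (n : ℤ) :
    tubeDeck ℓ θ₀ n (cylPoint r θ z) = cylPoint r (θ - n * θ₀) (z + n * ℓ) := by
  ext i
  fin_cases i <;> simp [tubeDeck, cylPoint, Real.cos_sub, Real.sin_sub] <;> ring

theorem tubeDeck_zero (ℓ θ₀ : ℝ) (p : Fin 3 → ℝ) : tubeDeck ℓ θ₀ 0 p = p := by
  ext i
  fin_cases i <;> simp [tubeDeck]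

theorem tubeDeck_add (ℓ θ₀ : ℝ) (m n : ℤ) (p : Fin 3 → ℝ) :
    tubeDeck ℓ θ₀ (m + n) p = tubeDeck ℓ θ₀ m (tubeDeck ℓ θ₀ n p) := by
  ext i
  fin_cases i <;> simp [tubeDeck, add_mul, Real.cos_add, Real.sin_add] <;> ring

/-- Two points of the solid cylinder are identified when a power of the screw motion takes one to
the other; the identification is generated by `(r, θ, z + ℓ) ∼ (r, θ + θ₀, z)`. -/
def tubeSetoid (R ℓ θ₀ : ℝ) : Setoid (tubeCover R) where
  r p q := ∃ n : ℤ, (q : Fin 3 → ℝ) = tubeDeck ℓ θ₀ n p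
  iseqv :=
    { refl := fun p => ⟨0, (tubeDeck_zero ℓ θ₀ p).symm⟩
      symm := by
        rintro p q ⟨n, hn⟩
        refine ⟨-n, ?_⟩
        rw [hn, ← tubeDeck_add, neg_add_cancel, tubeDeck_zero]
      trans := by
        rintro p q s ⟨n, hn⟩ ⟨m, hm⟩
        refine ⟨m + n, ?_⟩
        rw [hm, hn, tubeDeck_add] }

/-- The (open) Margulis tube of radius `R`, core length `ℓ` and twist parameter `θ₀`. -/
def MargulisTube (R ℓ θ₀ : ℝ) : Type := Quotient (tubeSetoid R ℓ θ₀)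

open Classical in
/-- The lift of a function on the tube to the solid cylinder (and `0` outside of it). -/
noncomputable def tubeLift {R ℓ θ₀ : ℝ} (f : MargulisTube R ℓ θ₀ → ℝ) (p : Fin 3 → ℝ) : ℝ :=
  if hp : p ∈ tubeCover R then f (Quotient.mk (tubeSetoid R ℓ θ₀) ⟨p, hp⟩) else 0

/-- A function on the tube is harmonic if it is `C²` and its Laplacian with respect to the
hyperbolic metric vanishes (both read on the universal cover). -/
structure IsHarmonicOnTube {R ℓ θ₀ : ℝ} (f : MargulisTube R ℓ θ₀ → ℝ) : Prop where
  contDiffOn : ContDiffOn ℝ 2 (tubeLift f) (tubeCover R)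
  laplace_eq_zero : ∀ p ∈ tubeCover R, laplaceBeltrami tubeMetric (tubeLift f) p = 0

theorem cylPoint_mem_tubeCover {R r : ℝ} (h0 : 0 ≤ r) (hr : r < R) (θ z : ℝ) :
    cylPoint r θ z ∈ tubeCover R := by
  have h1 : 0 ≤ Real.sinh r := Real.sinh_nonneg_iff.2 h0
  have h2 : Real.sinh r < Real.sinh R := Real.sinh_lt_sinh.2 hr
  have h3 : (Real.sinh r * Real.cos θ) ^ 2 + (Real.sinh r * Real.sin θ) ^ 2
      = Real.sinh r ^ 2 := by
    linear_combination (Real.sinh r ^ 2) * Real.sin_sq_add_cos_sq θ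
  simp only [tubeCover, cylPoint, Set.mem_ofPred_eq, Matrix.cons_val_zero, Matrix.cons_val_one, h3]
  exact pow_lt_pow_left₀ h2 h1 two_ne_zero

/-- The point of the tube with cylindrical coordinates `q = (r, θ, z)`, `0 ≤ r < R`. -/
noncomputable def tubePoint {R : ℝ} (ℓ θ₀ : ℝ) (q : Set.Ico (0 : ℝ) R × ℝ × ℝ) :
    MargulisTube R ℓ θ₀ :=
  Quotient.mk (tubeSetoid R ℓ θ₀)
    ⟨cylPoint q.1 q.2.1 q.2.2, cylPoint_mem_tubeCover q.1.2.1 q.1.2.2 q.2.1 q.2.2⟩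

/-- The radial factor
`tanhᵏ r · ₂F₁ (k/2 + i (mπ/ℓ + kθ₀/(2ℓ)), k/2 - i (mπ/ℓ + kθ₀/(2ℓ)); 1 + k; tanh² r)`. -/
noncomputable def radialTerm (ℓ θ₀ : ℝ) (k : ℕ) (m : ℤ) (r : ℝ) : ℂ :=
  (Real.tanh r : ℂ) ^ k *
    ordinaryHypergeometric
      ((k : ℂ) / 2 + Complex.I * (m * Real.pi / ℓ + k * θ₀ / (2 * ℓ)))
      ((k : ℂ) / 2 - Complex.I * (m * Real.pi / ℓ + k * θ₀ / (2 * ℓ)))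
      (1 + (k : ℂ)) ((Real.tanh r : ℂ) ^ 2)

/-- The phase `kθ + (2πm/ℓ) z + (kθ₀/ℓ) z`. -/
noncomputable def tubePhase (ℓ θ₀ : ℝ) (k : ℕ) (m : ℤ) (θ z : ℝ) : ℝ :=
  k * θ + 2 * Real.pi * m / ℓ * z + k * θ₀ / ℓ * z

/-! The proof separates variables. For fixed `r` the lift of `f` is a function of `(θ, z)` that is
`2π`-periodic in `θ` and satisfies the twist `(θ, z + ℓ) ∼ (θ + θ₀, z)`. The characters `exp (i (kθ
+ νz))` with this invariance have `ν = coreFreq ℓ θ₀ k m`. Let `c(r)` be the corresponding Fourier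
coefficient.

With `D = sinh r cosh r d/dr`, the Laplace equation multiplied by `sinh² r cosh² r` reads `D²U +
cosh² r U_θθ + sinh² r U_zz = 0`. Integration by parts gives `D²c = (k² cosh² r + ν² sinh² r) c`
(`cylMode_laplace`). In `t = tanh r` the operator `D` is `t d/dt`, and the equation becomes the
hypergeometric one, `(1 - t²) D²c = (k² + ν² t²) c`, solved by the power series `Φ = radialSeries k
ν 0` (`radialSeries_ode`). No second solution is needed: the Wronskian `Dc · Φ - c · DΦ` is
constant, and it vanishes at the core because `D` carries the factor `sinh r` and both functions are
differentiable there. Hence `c = α Φ` (`exists_cylMode_eq`).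

Convergence combines two gains. Two derivatives in `z` give `|c(r')| ≤ C / (1 + ν²)`, uniformly in
`k` and `m`. Since `Φ` has nonnegative coefficients and starts at `t^k`, passing from `r'` to `r <
r'` gains `(tanh r / tanh r')^k`. The resulting bounds are summable over all `(k, m)`, so the
Fourier series converges absolutely to `f` (`hasSum_cylMode`), and monotonicity of `Φ` turns
summability at one radius into a Weierstrass majorant at all smaller radii. -/

open Filter Topology MeasureTheory Set

/-! ### The radial power series and its differential equation -/

/-- The Taylor coefficients of `₂F₁ (k/2 + iν/2, k/2 - iν/2; 1 + k; x)`. -/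
noncomputable def radialCoeff (k : ℕ) (ν : ℝ) (n : ℕ) : ℝ :=
  ∏ j ∈ Finset.range n, ((k / 2 + j : ℝ) ^ 2 + (ν / 2) ^ 2) / ((1 + k + j) * (j + 1))

theorem radialCoeff_zero (k : ℕ) (ν : ℝ) : radialCoeff k ν 0 = 1 := by
  simp [radialCoeff]

theorem radialCoeff_succ (k : ℕ) (ν : ℝ) (n : ℕ) :
    radialCoeff k ν (n + 1) = radialCoeff k ν n *
      (((k / 2 + n : ℝ) ^ 2 + (ν / 2) ^ 2) / ((1 + k + n) * (n + 1))) := by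
  rw [radialCoeff, Finset.prod_range_succ, radialCoeff]

theorem radialCoeff_nonneg (k : ℕ) (ν : ℝ) (n : ℕ) : 0 ≤ radialCoeff k ν n :=
  Finset.prod_nonneg fun _ _ => by positivity

/-- Coefficient form of `(D² - k²)Φ = t² (D² + ν²)Φ` with `D = t d/dt`, since `D` multiplies
`t^(2n+k)` by `2n + k`. -/
theorem radialCoeff_recurrence (k : ℕ) (ν : ℝ) (n : ℕ) :
    radialCoeff k ν (n + 1) * ((2 * (n + 1 : ℝ) + k) ^ 2 - k ^ 2) =
      radialCoeff k ν n * ((2 * n + k : ℝ) ^ 2 + ν ^ 2) := by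
  rw [radialCoeff_succ]
  have h1 : (1 + k + n : ℝ) ≠ 0 := by positivity
  have h2 : (n + 1 : ℝ) ≠ 0 := by positivity
  field_simp
  ring

/-- Consecutive ratios are at most `1` once `n ≥ k² + ν²`, so only a finite initial segment matters;
its sum serves as the bound. -/
theorem exists_radialCoeff_le (k : ℕ) (ν : ℝ) : ∃ M, ∀ n, radialCoeff k ν n ≤ M := by
  obtain ⟨N, hN⟩ := exists_nat_ge ((k : ℝ) ^ 2 + ν ^ 2)
  have hstep : ∀ n, N ≤ n → radialCoeff k ν n ≤ radialCoeff k ν N := by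
    intro n hn
    induction n, hn using Nat.le_induction with
    | base => exact le_rfl
    | succ n hn ih =>
      refine le_trans ?_ ih
      rw [radialCoeff_succ]
      refine mul_le_of_le_one_right (radialCoeff_nonneg k ν n) ?_
      have hn' : (N : ℝ) ≤ n := by exact_mod_cast hn
      rw [div_le_one (by positivity)]
      nlinarith
  refine ⟨∑ j ∈ Finset.range (N + 1), radialCoeff k ν j, fun n => ?_⟩
  have hle : ∀ j, j ≤ N → radialCoeff k ν j ≤ ∑ j ∈ Finset.range (N + 1), radialCoeff k ν j :=
    fun j hj => Finset.single_le_sum (f := fun j => radialCoeff k ν j)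
      (fun i _ => radialCoeff_nonneg k ν i) (Finset.mem_range.2 (Nat.lt_succ_of_le hj))
  rcases le_total n N with h | h
  · exact hle n h
  · exact (hstep n h).trans (hle N le_rfl)

/-- The series `∑ (2n + k)ʲ pₙ t²ⁿ⁺ᵏ`, where `pₙ` are the hypergeometric coefficients. -/
noncomputable def radialSeries (k : ℕ) (ν : ℝ) (j : ℕ) (t : ℝ) : ℝ :=
  ∑' n : ℕ, (2 * n + k : ℝ) ^ j * radialCoeff k ν n * t ^ (2 * n + k)

theorem summable_weight_pow (k j : ℕ) {t : ℝ} (h0 : 0 ≤ t) (ht : t < 1) :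
    Summable fun n : ℕ => (2 * n + k : ℝ) ^ j * t ^ n := by
  have h := summable_pow_mul_geometric_of_norm_lt_one (R := ℝ) j
    (by rwa [Real.norm_of_nonneg h0] : ‖t‖ < 1)
  have h' := (h.comp_injective Nat.succ_injective).mul_left ((2 + k : ℝ) ^ j)
  rcases h0.eq_or_lt with rfl | hpos
  · refine summable_of_ne_finset_zero (s := {0}) fun n hn => ?_
    simp [show n ≠ 0 by simpa using hn]
  refine Summable.of_nonneg_of_le (fun n => by positivity) (fun n => ?_) (h'.mul_left t⁻¹)
  have h1 : (2 * n + k : ℝ) ≤ (2 + k) * (n + 1) := by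
    have : (0 : ℝ) ≤ n * k := by positivity
    nlinarith
  have h2 : (2 * n + k : ℝ) ^ j ≤ ((2 + k) * (n + 1)) ^ j := pow_le_pow_left₀ (by positivity) h1 j
  calc (2 * n + k : ℝ) ^ j * t ^ n ≤ ((2 + k) * (n + 1)) ^ j * t ^ n := by gcongr
    _ = _ := by
      simp only [Function.comp, Nat.succ_eq_add_one, Nat.cast_add, Nat.cast_one]
      rw [mul_pow, pow_succ]
      field_simp

/-- The exponent `e` is left free so that one majorant, with the crude power `T ^ n`, covers both
the series and its termwise derivative. -/
theorem norm_radial_term_le {k : ℕ} {ν M : ℝ} (hM : ∀ n, radialCoeff k ν n ≤ M) (j : ℕ) {t T : ℝ}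
    (hT : T ≤ 1) (ht : |t| ≤ T) {e : ℕ} (n : ℕ) (he : n ≤ e) :
    ‖(2 * n + k : ℝ) ^ j * radialCoeff k ν n * t ^ e‖ ≤ M * ((2 * n + k : ℝ) ^ j * T ^ n) := by
  have hT0 : 0 ≤ T := (abs_nonneg t).trans ht
  have h1 : |t| ^ e ≤ T ^ n :=
    (pow_le_pow_left₀ (abs_nonneg t) ht e).trans (pow_le_pow_of_le_one hT0 hT he)
  rw [norm_mul, norm_mul, Real.norm_of_nonneg (radialCoeff_nonneg k ν n), norm_pow t,
    Real.norm_eq_abs t, Real.norm_of_nonneg (by positivity : (0 : ℝ) ≤ (2 * n + k : ℝ) ^ j)]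
  calc (2 * n + k : ℝ) ^ j * radialCoeff k ν n * |t| ^ e
      ≤ (2 * n + k : ℝ) ^ j * M * T ^ n := by
        gcongr
        · exact mul_nonneg (by positivity) ((radialCoeff_nonneg k ν n).trans (hM n))
        · exact hM n
    _ = _ := by ring

theorem summable_radialSeries (k : ℕ) (ν : ℝ) (j : ℕ) {t : ℝ} (ht : |t| < 1) :
    Summable fun n : ℕ => (2 * n + k : ℝ) ^ j * radialCoeff k ν n * t ^ (2 * n + k) := by
  obtain ⟨M, hM⟩ := exists_radialCoeff_le k ν
  exact Summable.of_norm_bounded ((summable_weight_pow k j (abs_nonneg t) ht).mul_left M)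
    fun n => norm_radial_term_le hM j ht.le le_rfl n (by omega)

/-- Termwise differentiation: the index `j` counts applications of `t d/dt`. Stating `t * d` instead
of `d` avoids the truncated exponent `2n + k - 1` and division at `t = 0`. -/
theorem hasDerivAt_radialSeries (k : ℕ) (ν : ℝ) (j : ℕ) {t : ℝ} (ht : |t| < 1) :
    ∃ d, HasDerivAt (radialSeries k ν j) d t ∧ t * d = radialSeries k ν (j + 1) t := by
  obtain ⟨M, hM⟩ := exists_radialCoeff_le k ν
  obtain ⟨T, hT, hT1⟩ := exists_between ht
  have hT0 : 0 < T := (abs_nonneg t).trans_lt hT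
  have hsum : Summable fun n : ℕ => M * T⁻¹ * ((2 * n + k : ℝ) ^ (j + 1) * T ^ n) :=
    (summable_weight_pow k (j + 1) hT0.le hT1).mul_left _
  refine ⟨∑' n : ℕ, (2 * n + k : ℝ) ^ j * radialCoeff k ν n *
    ((2 * n + k : ℕ) * t ^ (2 * n + k - 1)), ?_, ?_⟩
  · refine hasDerivAt_tsum_of_isPreconnected (t := Set.Ioo (-T) T) (y₀ := 0) hsum isOpen_Ioo
      (convex_Ioo _ _).isPreconnected
      (g' := fun (n : ℕ) (y : ℝ) => (2 * n + k : ℝ) ^ j * radialCoeff k ν n *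
        ((2 * n + k : ℕ) * y ^ (2 * n + k - 1))) (fun n y _ => ?_) (fun n y hy => ?_)
      (by simpa using hT0) ?_ (abs_lt.1 hT)
    · exact (hasDerivAt_pow (2 * n + k) y).const_mul _
    · have hy' : |y| ≤ T := (abs_lt.2 hy).le
      rcases Nat.eq_zero_or_pos (2 * n + k) with h | h
      · rw [h]; simp only [Nat.cast_zero, zero_mul, mul_zero, norm_zero]
        have := (radialCoeff_nonneg k ν 0).trans (hM 0)
        positivity
      have h3 := norm_radial_term_le hM (j + 1) hT1.le hy' (e := 2 * n + k - 1 + 1) n (by omega)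
      have h4 := norm_radial_term_le hM (j + 1) hT1.le (t := T) (by rw [abs_of_pos hT0])
        (e := 2 * n + k - 1 + 1) n (by omega)
      -- One factor `T` restores the lost power and makes this a term of level `j + 1` at `T`; hence
      -- the `T⁻¹` in `hsum`.
      have h5 : ‖(2 * n + k : ℝ) ^ j * radialCoeff k ν n *
          ((2 * n + k : ℕ) * y ^ (2 * n + k - 1))‖ * T ≤
          ‖(2 * n + k : ℝ) ^ (j + 1) * radialCoeff k ν n * T ^ (2 * n + k - 1 + 1)‖ := by
        simp only [norm_mul, norm_pow, Real.norm_eq_abs, abs_of_pos hT0, pow_succ]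
        push_cast
        have : |y| ^ (2 * n + k - 1) ≤ T ^ (2 * n + k - 1) := pow_le_pow_left₀ (abs_nonneg y) hy' _
        calc _ = |(2 * n + k : ℝ)| ^ j * |(2 * n + k : ℝ)| * |radialCoeff k ν n| *
              (|y| ^ (2 * n + k - 1) * T) := by ring
          _ ≤ _ := by gcongr
      have h6 := h5.trans h4
      rw [← le_div_iff₀ hT0] at h6
      exact h6.trans (le_of_eq (by ring))
    · exact summable_radialSeries k ν j (by simp)
  · rw [radialSeries, ← tsum_mul_left]
    refine tsum_congr fun n => ?_
    rcases Nat.eq_zero_or_pos (2 * n + k) with h | h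
    · have : (2 * n + k : ℝ) = 0 := by exact_mod_cast h
      rw [h, this]; simp
    · obtain ⟨e, he⟩ := Nat.exists_eq_succ_of_ne_zero h.ne'
      have : (2 * n + k : ℝ) = e + 1 := by exact_mod_cast he
      rw [he, this]; simp; ring

/-- The hypergeometric differential equation, in terms of the Euler operator `t d/dt`. -/
theorem radialSeries_ode (k : ℕ) (ν : ℝ) {t : ℝ} (ht : |t| < 1) :
    (1 - t ^ 2) * radialSeries k ν 2 t = (k ^ 2 + ν ^ 2 * t ^ 2) * radialSeries k ν 0 t := by
  have h0 := summable_radialSeries k ν 0 ht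
  have h2 := summable_radialSeries k ν 2 ht
  have h3 : radialSeries k ν 2 t - k ^ 2 * radialSeries k ν 0 t =
      t ^ 2 * (radialSeries k ν 2 t + ν ^ 2 * radialSeries k ν 0 t) := by
    unfold radialSeries
    rw [← tsum_mul_left, ← tsum_mul_left, ← h2.tsum_sub (h0.mul_left _),
      ← h2.tsum_add (h0.mul_left _), ← tsum_mul_left, (h2.sub (h0.mul_left _)).tsum_eq_zero_add]
    -- The leading term `t^k` is killed by `D² - k²`; the remaining terms match the right side after
    -- an index shift.
    have hz : ((2 * ((0 : ℕ) : ℝ) + k) ^ 2 * radialCoeff k ν 0 * t ^ (2 * 0 + k) -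
      k ^ 2 * ((2 * ((0 : ℕ) : ℝ) + k) ^ 0 * radialCoeff k ν 0 * t ^ (2 * 0 + k))) = 0 := by
      simp; ring
    rw [hz, zero_add]
    refine tsum_congr fun n => ?_
    have h := radialCoeff_recurrence k ν n
    rw [show 2 * (n + 1) + k = 2 * n + k + 2 by ring, pow_add]
    push_cast
    linear_combination t ^ (2 * n + k) * t ^ 2 * h
  linear_combination h3

theorem radialSeries_pos (k : ℕ) (ν : ℝ) {t : ℝ} (h0 : 0 < t) (h1 : t < 1) :
    0 < radialSeries k ν 0 t := by
  have hs := summable_radialSeries k ν 0 (t := t) (by rwa [abs_of_pos h0])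
  refine hs.tsum_pos (fun n => mul_nonneg (mul_nonneg (by positivity) (radialCoeff_nonneg k ν n))
    (by positivity)) 0 ?_
  rw [radialCoeff_zero]
  simp [h0]

theorem radialSeries_nonneg (k : ℕ) (ν : ℝ) {t : ℝ} (h0 : 0 ≤ t) :
    0 ≤ radialSeries k ν 0 t :=
  tsum_nonneg fun n => mul_nonneg (mul_nonneg (by positivity) (radialCoeff_nonneg k ν n))
    (by positivity)

/-- Every term is a nonnegative multiple of `t^k · t^(2n)`. The factor `(t₁ / t₂) ^ k` is the source
of geometric decay in `k`, uniformly in `ν`. -/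
theorem radialSeries_le (k : ℕ) (ν : ℝ) {t₁ t₂ : ℝ} (h0 : 0 ≤ t₁) (h : t₁ ≤ t₂) (hpos : 0 < t₂)
    (h1 : t₂ < 1) : radialSeries k ν 0 t₁ ≤ (t₁ / t₂) ^ k * radialSeries k ν 0 t₂ := by
  have hs1 := summable_radialSeries k ν 0 (t := t₁) (by rw [abs_of_nonneg h0]; linarith)
  have hs2 := summable_radialSeries k ν 0 (t := t₂) (by rwa [abs_of_pos hpos])
  unfold radialSeries
  rw [← tsum_mul_left]
  refine hs1.tsum_le_tsum (fun n => ?_) (hs2.mul_left _)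
  have hc := radialCoeff_nonneg k ν n
  have hp : t₁ ^ (2 * n) ≤ t₂ ^ (2 * n) := pow_le_pow_left₀ h0 h _
  have hk : (t₁ / t₂) ^ k * t₂ ^ k = t₁ ^ k := by rw [← mul_pow, div_mul_cancel₀ _ hpos.ne']
  simp only [pow_zero, one_mul, pow_add]
  calc radialCoeff k ν n * (t₁ ^ (2 * n) * t₁ ^ k) ≤ radialCoeff k ν n * (t₂ ^ (2 * n) * t₁ ^ k) := by
        gcongr
    _ = _ := by rw [← hk]; ring

/-! ### Identification with the hypergeometric function -/

/-- The frequency in the direction of the core. -/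
noncomputable def coreFreq (ℓ θ₀ : ℝ) (k : ℕ) (m : ℤ) : ℝ :=
  2 * Real.pi * m / ℓ + k * θ₀ / ℓ

/-- The two upper parameters are `k/2 ± iν/2`, so their Pochhammer factors pair into the real
numbers `(k/2 + j)² + (ν/2)²`. -/
theorem radialTerm_eq (ℓ θ₀ : ℝ) (k : ℕ) (m : ℤ) (r : ℝ) :
    radialTerm ℓ θ₀ k m r = (radialSeries k (coreFreq ℓ θ₀ k m) 0 (Real.tanh r) : ℝ) := by
  have hcoef : ∀ (ν : ℝ) (n : ℕ), ((n.factorial : ℂ)⁻¹ *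
      (ascPochhammer ℂ n).eval ((k : ℂ) / 2 + Complex.I * (ν / 2)) *
      (ascPochhammer ℂ n).eval ((k : ℂ) / 2 - Complex.I * (ν / 2)) *
      ((ascPochhammer ℂ n).eval (1 + (k : ℂ)))⁻¹) = (radialCoeff k ν n : ℝ) := by
    intro ν n
    induction n with
    | zero => simp [radialCoeff]
    | succ n ih =>
      rw [radialCoeff_succ, Complex.ofReal_mul, ← ih]
      simp only [ascPochhammer_succ_right, Polynomial.eval_mul, Polynomial.eval_add,
        Polynomial.eval_X, Polynomial.eval_natCast, Nat.factorial_succ, Nat.cast_mul]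
      have h1 : (1 + k + n : ℂ) ≠ 0 := by norm_cast; omega
      have h2 : (n + 1 : ℂ) ≠ 0 := by norm_cast
      push_cast
      have hI : ((k : ℂ) / 2 + Complex.I * (ν / 2) + n) * ((k : ℂ) / 2 - Complex.I * (ν / 2) + n) =
          ((k / 2 + n : ℂ) ^ 2 + (ν / 2) ^ 2) := by
        linear_combination (-(ν / 2 : ℂ) ^ 2) * Complex.I_sq
      rw [← hI]
      simp only [div_eq_mul_inv, mul_inv]
      ring
  have harg : ((m : ℂ) * Real.pi / ℓ + k * θ₀ / (2 * ℓ)) = (coreFreq ℓ θ₀ k m : ℝ) / 2 := by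
    rw [coreFreq]; push_cast
    rcases eq_or_ne (ℓ : ℂ) 0 with h | h
    · simp [h]
    · field_simp
  rw [radialTerm, harg, ordinaryHypergeometric_eq_tsum, radialSeries, Complex.ofReal_tsum,
    ← tsum_mul_left]
  refine tsum_congr fun n => ?_
  rw [hcoef]
  push_cast
  simp only [smul_eq_mul, pow_zero, one_mul]
  rw [pow_add, pow_mul]; ring

/-! ### Integrals with a parameter and Fourier series -/

theorem hasDerivAt_setIntegral_of_continuousOn {X : Type*} [TopologicalSpace X]
    [MeasurableSpace X] [OpensMeasurableSpace X] {μ : Measure X} [IsFiniteMeasureOnCompacts μ]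
    {K : Set X} (hK : IsCompact K) (hKm : MeasurableSet K) {I : Set ℝ} (hI : IsOpen I)
    {F F' : ℝ → X → ℂ} (hF : ContinuousOn (Function.uncurry F) (I ×ˢ K))
    (hF' : ContinuousOn (Function.uncurry F') (I ×ˢ K))
    (hd : ∀ r ∈ I, ∀ x ∈ K, HasDerivAt (F · x) (F' r x) r) {r : ℝ} (hr : r ∈ I) :
    HasDerivAt (fun r => ∫ x in K, F r x ∂μ) (∫ x in K, F' r x ∂μ) r := by
  have hslice : ∀ {G : ℝ → X → ℂ}, ContinuousOn (Function.uncurry G) (I ×ˢ K) →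
      ∀ s ∈ I, ContinuousOn (G s) K := fun {G} hG s hs =>
    hG.comp (f := fun x => (s, x)) (by fun_prop) fun x hx => ⟨hs, hx⟩
  -- On the compact set `closedBall r ε ×ˢ K` the derivative is bounded, and that constant is the
  -- dominating function.
  obtain ⟨ε, hε, hεI⟩ := Metric.nhds_basis_closedBall.mem_iff.1 (hI.mem_nhds hr)
  obtain ⟨C, hC⟩ := ((isCompact_closedBall r ε).prod hK).exists_bound_of_continuousOn
    (hF'.mono (prod_mono hεI subset_rfl))
  refine (hasDerivAt_integral_of_dominated_loc_of_deriv_le (F' := F') (bound := fun _ => C)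
    (s := Metric.closedBall r ε) (Metric.closedBall_mem_nhds r hε) ?_ ?_ ?_ ?_ ?_ ?_).2
  · filter_upwards [hI.mem_nhds hr] with s hs
    exact (hslice hF s hs).aestronglyMeasurable_of_isCompact hK hKm
  · exact (hslice hF r hr).integrableOn_compact' hK hKm
  · exact (hslice hF' r hr).aestronglyMeasurable_of_isCompact hK hKm
  · filter_upwards [ae_restrict_mem hKm] with x hx s hs
    exact hC (s, x) ⟨hs, hx⟩
  · have : IsFiniteMeasure (μ.restrict K) := ⟨by simpa using hK.measure_lt_top⟩
    exact integrable_const C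
  · filter_upwards [ae_restrict_mem hKm] with x hx s hs
    exact hd s (hεI hs) x hx

theorem Function.Periodic.hasSum_fourier_of_summable {g : ℝ → ℂ} {T : ℝ} (hT : 0 < T)
    (hg : Continuous g) (hp : Function.Periodic g T)
    (hs : Summable fun n : ℤ =>
      (1 / T : ℂ) * ∫ x in (0 : ℝ)..T, g x * Complex.exp (-(2 * Real.pi * n * x / T : ℝ) * Complex.I))
    (x : ℝ) :
    HasSum (fun n : ℤ => ((1 / T : ℂ) * ∫ x in (0 : ℝ)..T,
      g x * Complex.exp (-(2 * Real.pi * n * x / T : ℝ) * Complex.I)) *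
        Complex.exp ((2 * Real.pi * n * x / T : ℝ) * Complex.I)) (g x) := by
  have : Fact (0 < T) := ⟨hT⟩
  let G : C(AddCircle T, ℂ) := ⟨hp.lift, continuous_coinduced_dom.2 hg⟩
  have hc : ∀ n : ℤ, fourierCoeff G n = (1 / T : ℂ) * ∫ x in (0 : ℝ)..T,
      g x * Complex.exp (-(2 * Real.pi * n * x / T : ℝ) * Complex.I) := by
    intro n
    rw [fourierCoeff_eq_intervalIntegral _ _ 0, zero_add, Complex.real_smul]
    push_cast
    congr 1
    refine intervalIntegral.integral_congr fun y _ => ?_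
    simp only [fourier_coe_apply, smul_eq_mul]
    rw [show G (y : AddCircle T) = g y from hp.lift_coe y, mul_comm]
    congr 2
    push_cast
    ring
  have h := has_pointwise_sum_fourier_series_of_summable (f := G)
    (by simpa only [← hc] using hs) (x : AddCircle T)
  rw [show G (x : AddCircle T) = g x from hp.lift_coe x] at h
  simp only [hc, fourier_coe_apply, smul_eq_mul] at h
  convert h using 4
  push_cast
  ring

/-! ### Calculus of partial derivatives -/

section PartialD

variable {n : ℕ} {p : Fin n → ℝ} {g h : (Fin n → ℝ) → ℝ}

theorem partialD_add (i : Fin n) (hg : DifferentiableAt ℝ g p) (hh : DifferentiableAt ℝ h p) :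
    partialD i (fun y => g y + h y) p = partialD i g p + partialD i h p := by
  simp only [partialD]
  rw [fderiv_fun_add hg hh]; rfl

theorem partialD_mul (i : Fin n) (hg : DifferentiableAt ℝ g p) (hh : DifferentiableAt ℝ h p) :
    partialD i (fun y => g y * h y) p = g p * partialD i h p + partialD i g p * h p := by
  simp only [partialD]
  rw [fderiv_fun_mul hg hh]; simp [mul_comm]

theorem partialD_of_hasDerivAt (i : Fin n) {d : ℝ} (hg : DifferentiableAt ℝ g p)
    (hd : HasDerivAt (fun t : ℝ => g (p + t • Pi.single i 1)) d 0) : partialD i g p = d := by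
  have h1 : HasDerivAt (fun t : ℝ => p + t • (Pi.single i 1 : Fin n → ℝ)) (Pi.single i 1) 0 := by
    simpa using ((hasDerivAt_id (0 : ℝ)).smul_const (Pi.single i 1 : Fin n → ℝ)).const_add p
  have h2 : HasFDerivAt g (fderiv ℝ g p) (p + (0 : ℝ) • (Pi.single i 1 : Fin n → ℝ)) := by
    simpa using hg.hasFDerivAt
  exact (h2.comp_hasDerivAt (0 : ℝ) h1).unique hd

theorem hasDerivAt_comp_curve {γ : ℝ → Fin n → ℝ} {γ' : Fin n → ℝ} {t : ℝ}
    (hg : DifferentiableAt ℝ g (γ t)) (hγ : HasDerivAt γ γ' t) :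
    HasDerivAt (fun s => g (γ s)) (∑ i, γ' i * partialD i g (γ t)) t := by
  have h1 := hg.hasFDerivAt.comp_hasDerivAt t hγ
  have h2 : fderiv ℝ g (γ t) γ' = ∑ i, γ' i * partialD i g (γ t) := by
    conv_lhs => rw [pi_eq_sum_univ' γ']
    simp only [map_sum, map_smul, smul_eq_mul, partialD]
  rwa [h2] at h1

theorem contDiffOn_partialD {s : Set (Fin n → ℝ)} (hs : IsOpen s) {m : WithTop ℕ∞}
    (hg : ContDiffOn ℝ (m + 1) g s) (i : Fin n) : ContDiffOn ℝ m (partialD i g) s :=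
  (hg.fderiv_of_isOpen hs le_rfl).clm_apply contDiffOn_const

theorem partialD_comm {s : Set (Fin n → ℝ)} (hs : IsOpen s) (hg : ContDiffOn ℝ 2 g s) (hp : p ∈ s)
    (i j : Fin n) : partialD i (partialD j g) p = partialD j (partialD i g) p := by
  have hat : ContDiffAt ℝ 2 g p := hg.contDiffAt (hs.mem_nhds hp)
  have hsymm : IsSymmSndFDerivAt ℝ g p := hat.isSymmSndFDerivAt (by simp)
  have hd : DifferentiableAt ℝ (fderiv ℝ g) p :=
    (hat.fderiv_right (m := 1) (by norm_num)).differentiableAt (by norm_num)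
  have key : ∀ i j, partialD i (partialD j g) p =
      fderiv ℝ (fderiv ℝ g) p (Pi.single i 1) (Pi.single j 1) := by
    intro i j
    unfold partialD
    rw [fderiv_clm_apply hd (differentiableAt_const _)]
    simp
  rw [key, key, hsymm]

end PartialD

/-! ### The Laplacian in the smooth chart -/

theorem isOpen_tubeCover (R : ℝ) : IsOpen (tubeCover R) :=
  isOpen_lt (by fun_prop) continuous_const

/-- The hyperbolic volume `sinh r cosh r dr dθ dz` is exactly `dx dy dz` in this chart, so the
square roots disappear from the Laplacian. -/
theorem tubeMetric_det (p : Fin 3 → ℝ) : (tubeMetric p).det = 1 := by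
  have hw : 1 + p 0 ^ 2 + p 1 ^ 2 ≠ 0 := by positivity
  rw [Matrix.det_fin_three]
  simp [tubeMetric]
  field_simp
  ring

theorem tubeMetric_inv (p : Fin 3 → ℝ) : (tubeMetric p)⁻¹ =
    !![1 + p 0 ^ 2, p 0 * p 1, 0;
       p 0 * p 1, 1 + p 1 ^ 2, 0;
       0, 0, (1 + p 0 ^ 2 + p 1 ^ 2)⁻¹] := by
  have hw : 1 + p 0 ^ 2 + p 1 ^ 2 ≠ 0 := by positivity
  refine Matrix.inv_eq_right_inv ?_
  ext i j
  fin_cases i <;> fin_cases j <;>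
    simp [Matrix.mul_apply, Fin.sum_univ_three, tubeMetric, hw] <;> field_simp <;> ring

/-- Expansion of the divergence form. The coefficients `3x` and `3y` are the divergences of the
first two rows of the inverse metric, for instance `∂ₓ(1 + x²) + ∂_y(xy)`. -/
theorem laplaceBeltrami_tubeMetric {s : Set (Fin 3 → ℝ)} (hs : IsOpen s)
    {u : (Fin 3 → ℝ) → ℝ} (hu : ContDiffOn ℝ 2 u s) {p : Fin 3 → ℝ} (hp : p ∈ s) :
    laplaceBeltrami tubeMetric u p =
      (1 + p 0 ^ 2) * partialD 0 (partialD 0 u) p + 2 * (p 0 * p 1) * partialD 0 (partialD 1 u) p +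
      (1 + p 1 ^ 2) * partialD 1 (partialD 1 u) p + 3 * p 0 * partialD 0 u p +
      3 * p 1 * partialD 1 u p + (1 + p 0 ^ 2 + p 1 ^ 2)⁻¹ * partialD 2 (partialD 2 u) p := by
  have hv : ∀ i, DifferentiableAt ℝ (partialD i u) p := fun i =>
    ((contDiffOn_partialD (m := 1) hs (by simpa [one_add_one_eq_two] using hu) i).contDiffAt
      (hs.mem_nhds hp)).differentiableAt (by norm_num)
  have hc : ∀ i : Fin 3, DifferentiableAt ℝ (fun y : Fin 3 → ℝ => y i) p := fun i => by fun_prop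
  have hx : ∀ i j : Fin 3, DifferentiableAt ℝ (fun y : Fin 3 → ℝ => y i * y j) p := fun i j => by
    fun_prop
  have hx2 : ∀ i : Fin 3, DifferentiableAt ℝ (fun y : Fin 3 → ℝ => 1 + y i ^ 2) p := fun i => by
    fun_prop
  have hw : DifferentiableAt ℝ (fun y : Fin 3 → ℝ => (1 + y 0 ^ 2 + y 1 ^ 2)⁻¹) p := by
    refine DifferentiableAt.fun_inv (by fun_prop) ?_
    positivity
  have hd1 : ∀ i j : Fin 3, partialD i (fun y : Fin 3 → ℝ => y j) p = if i = j then 1 else 0 := by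
    intro i j
    have : (fun y : Fin 3 → ℝ => y j) = (ContinuousLinearMap.proj j : (Fin 3 → ℝ) →L[ℝ] ℝ) := rfl
    rw [partialD, this, ContinuousLinearMap.fderiv]
    simp [Pi.single_apply, eq_comm]
  have hd2 : ∀ i j : Fin 3, partialD i (fun y : Fin 3 → ℝ => 1 + y j ^ 2) p =
      2 * p j * if i = j then 1 else 0 := by
    intro i j
    have : (fun y : Fin 3 → ℝ => 1 + y j ^ 2) = fun y => 1 + y j * y j := by ext; ring
    rw [this, partialD_add i (differentiableAt_const _) (hx j j), partialD_mul i (hc j) (hc j), hd1]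
    simp only [partialD, fderiv_fun_const, Pi.zero_apply, zero_apply]
    ring
  have hdw : partialD 2 (fun y : Fin 3 → ℝ => (1 + y 0 ^ 2 + y 1 ^ 2)⁻¹) p = 0 :=
    partialD_of_hasDerivAt 2 hw (by simpa using hasDerivAt_const (0 : ℝ) _)
  simp only [laplaceBeltrami, tubeMetric_det, tubeMetric_inv, Real.sqrt_one, inv_one, one_mul,
    Fin.sum_univ_three]
  simp only [Matrix.of_apply, Matrix.cons_val', Matrix.cons_val_zero, Matrix.cons_val_one,
    Matrix.cons_val, zero_mul, add_zero, zero_add]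
  rw [partialD_add 0 ((hx2 0).fun_mul (hv 0)) ((hx 0 1).fun_mul (hv 1)),
    partialD_add 1 ((hx 0 1).fun_mul (hv 0)) ((hx2 1).fun_mul (hv 1)),
    partialD_mul 0 (hx2 0) (hv 0), partialD_mul 0 (hx 0 1) (hv 1), partialD_mul 1 (hx 0 1) (hv 0),
    partialD_mul 1 (hx2 1) (hv 1), partialD_mul 2 hw (hv 2), hdw,
    partialD_mul 0 (hc 0) (hc 1), partialD_mul 1 (hc 0) (hc 1), hd2, hd2,
    partialD_comm hs hu hp 1 0]
  simp only [hd1]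
  simp
  ring

/-! ### Harmonic functions in cylindrical coordinates -/

/-- Complex-valued functions of cylindrical coordinates `r` and `(θ, z)` with the given partial
derivatives, harmonic in the tube and compatible with its identifications. -/
structure IsCylHarmonic (R ℓ θ₀ : ℝ) (U Ur Urr Ut Utt Uz Uzz : ℝ → ℝ × ℝ → ℂ) : Prop where
  cont : ContinuousOn (Function.uncurry U) (Ioo (-R) R ×ˢ univ)
  cont_r : ContinuousOn (Function.uncurry Ur) (Ioo (-R) R ×ˢ univ)
  cont_rr : ContinuousOn (Function.uncurry Urr) (Ioo (-R) R ×ˢ univ)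
  cont_t : ContinuousOn (Function.uncurry Ut) (Ioo (-R) R ×ˢ univ)
  cont_tt : ContinuousOn (Function.uncurry Utt) (Ioo (-R) R ×ˢ univ)
  cont_z : ContinuousOn (Function.uncurry Uz) (Ioo (-R) R ×ˢ univ)
  cont_zz : ContinuousOn (Function.uncurry Uzz) (Ioo (-R) R ×ˢ univ)
  deriv_r : ∀ r ∈ Ioo (-R) R, ∀ x, HasDerivAt (U · x) (Ur r x) r
  deriv_rr : ∀ r ∈ Ioo (-R) R, ∀ x, HasDerivAt (Ur · x) (Urr r x) r
  deriv_t : ∀ r ∈ Ioo (-R) R, ∀ θ z, HasDerivAt (fun t => U r (t, z)) (Ut r (θ, z)) θ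
  deriv_tt : ∀ r ∈ Ioo (-R) R, ∀ θ z, HasDerivAt (fun t => Ut r (t, z)) (Utt r (θ, z)) θ
  deriv_z : ∀ r ∈ Ioo (-R) R, ∀ θ z, HasDerivAt (fun t => U r (θ, t)) (Uz r (θ, z)) z
  deriv_zz : ∀ r ∈ Ioo (-R) R, ∀ θ z, HasDerivAt (fun t => Uz r (θ, t)) (Uzz r (θ, z)) z
  laplace : ∀ r ∈ Ioo (-R) R, ∀ x,
    (Real.sinh r * Real.cosh r * (Real.cosh r ^ 2 + Real.sinh r ^ 2) : ℝ) * Ur r x +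
      (Real.sinh r ^ 2 * Real.cosh r ^ 2 : ℝ) * Urr r x + (Real.cosh r ^ 2 : ℝ) * Utt r x +
      (Real.sinh r ^ 2 : ℝ) * Uzz r x = 0
  periodic : ∀ r ∈ Ioo (-R) R, ∀ θ z, U r (θ + 2 * Real.pi, z) = U r (θ, z)
  twist : ∀ r ∈ Ioo (-R) R, ∀ θ z, U r (θ, z + ℓ) = U r (θ + θ₀, z)

/-- Negative `r` is admitted so that the core `r = 0` is an interior point of the radial interval,
where two-sided derivatives make sense. -/
theorem cylPoint_mem_tubeCover_of_mem_Ioo {R r : ℝ} (hr : r ∈ Ioo (-R) R) (θ z : ℝ) :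
    cylPoint r θ z ∈ tubeCover R := by
  have h := cylPoint_mem_tubeCover (abs_nonneg r) (abs_lt.2 hr) θ z
  rcases abs_cases r with ⟨h1, _⟩ | ⟨h1, _⟩ <;> rw [h1] at h
  · exact h
  · simpa [tubeCover, cylPoint, Real.sinh_neg] using h

theorem tubeLift_tubeDeck {R ℓ θ₀ : ℝ} (f : MargulisTube R ℓ θ₀ → ℝ) (n : ℤ) {p : Fin 3 → ℝ}
    (hp : p ∈ tubeCover R) (hq : tubeDeck ℓ θ₀ n p ∈ tubeCover R) :
    tubeLift f (tubeDeck ℓ θ₀ n p) = tubeLift f p := by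
  rw [tubeLift, tubeLift, dif_pos hq, dif_pos hp]
  congr 1
  exact (Quotient.sound (s := tubeSetoid R ℓ θ₀) ⟨n, rfl⟩).symm

theorem IsHarmonicOnTube.exists_isCylHarmonic {R ℓ θ₀ : ℝ} {f : MargulisTube R ℓ θ₀ → ℝ}
    (hf : IsHarmonicOnTube f) : ∃ Ur Urr Ut Utt Uz Uzz, IsCylHarmonic R ℓ θ₀
      (fun r x => (tubeLift f (cylPoint r x.1 x.2) : ℂ)) Ur Urr Ut Utt Uz Uzz := by
  obtain ⟨hu, hL⟩ := hf
  set u := tubeLift f with hu_def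
  have hs := isOpen_tubeCover R
  have hv1 : ∀ i, ContDiffOn ℝ 1 (partialD i u) (tubeCover R) :=
    contDiffOn_partialD (m := 1) hs (by simpa [one_add_one_eq_two] using hu)
  have hv : ∀ i, ∀ p ∈ tubeCover R, DifferentiableAt ℝ (partialD i u) p := fun i p hp =>
    ((hv1 i).contDiffAt (hs.mem_nhds hp)).differentiableAt (by norm_num)
  have hud : ∀ p ∈ tubeCover R, DifferentiableAt ℝ u p := fun p hp =>
    (hu.contDiffAt (hs.mem_nhds hp)).differentiableAt (by norm_num)
  have hw1 : ∀ i j, ContinuousOn (partialD i (partialD j u)) (tubeCover R) := fun i j =>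
    (contDiffOn_partialD (m := 0) hs (by simpa using hv1 j) i).continuousOn
  have hmem : ∀ r ∈ Ioo (-R) R, ∀ x : ℝ × ℝ, cylPoint r x.1 x.2 ∈ tubeCover R :=
    fun r hr x => cylPoint_mem_tubeCover_of_mem_Ioo hr _ _
  have hP : Continuous fun q : ℝ × ℝ × ℝ => cylPoint q.1 q.2.1 q.2.2 := by
    refine continuous_pi fun i => ?_
    fin_cases i <;> simp [cylPoint] <;> fun_prop
  have hcomp : ∀ {g : (Fin 3 → ℝ) → ℝ}, ContinuousOn g (tubeCover R) →
      ContinuousOn (fun q : ℝ × ℝ × ℝ => g (cylPoint q.1 q.2.1 q.2.2)) (Ioo (-R) R ×ˢ univ) :=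
    fun {g} hg => hg.comp hP.continuousOn fun q hq => hmem q.1 hq.1 q.2
  have hcu := hcomp hu.continuousOn
  have hcv := fun i => hcomp (hv1 i).continuousOn
  have hcw := fun i j => hcomp (hw1 i j)
  have hγr : ∀ r θ z, HasDerivAt (fun r => cylPoint r θ z)
      ![Real.cosh r * Real.cos θ, Real.cosh r * Real.sin θ, 0] r := by
    intro r θ z
    refine hasDerivAt_pi.2 fun i => ?_
    fin_cases i
    · exact (Real.hasDerivAt_sinh r).mul_const _
    · exact (Real.hasDerivAt_sinh r).mul_const _
    · exact hasDerivAt_const _ _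
  have hγt : ∀ r θ z, HasDerivAt (fun θ => cylPoint r θ z)
      ![Real.sinh r * -Real.sin θ, Real.sinh r * Real.cos θ, 0] θ := by
    intro r θ z
    refine hasDerivAt_pi.2 fun i => ?_
    fin_cases i
    · exact (Real.hasDerivAt_cos θ).const_mul _
    · exact (Real.hasDerivAt_sin θ).const_mul _
    · exact hasDerivAt_const _ _
  have hγz : ∀ r θ z, HasDerivAt (fun z => cylPoint r θ z) ![0, 0, 1] z := by
    intro r θ z
    refine hasDerivAt_pi.2 fun i => ?_
    fin_cases i
    · exact hasDerivAt_const _ _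
    · exact hasDerivAt_const _ _
    · exact hasDerivAt_id _
  have hdr : ∀ {g : (Fin 3 → ℝ) → ℝ}, (∀ p ∈ tubeCover R, DifferentiableAt ℝ g p) →
      ∀ r ∈ Ioo (-R) R, ∀ θ z, HasDerivAt (fun r => g (cylPoint r θ z))
        (Real.cosh r * Real.cos θ * partialD 0 g (cylPoint r θ z) +
          Real.cosh r * Real.sin θ * partialD 1 g (cylPoint r θ z)) r := fun {g} hg r hr θ z => by
    simpa [Fin.sum_univ_three] using hasDerivAt_comp_curve (γ := fun r => cylPoint r θ z)
      (hg _ (hmem r hr (θ, z))) (hγr r θ z)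
  have hdt : ∀ {g : (Fin 3 → ℝ) → ℝ}, (∀ p ∈ tubeCover R, DifferentiableAt ℝ g p) →
      ∀ r ∈ Ioo (-R) R, ∀ θ z, HasDerivAt (fun θ => g (cylPoint r θ z))
        (Real.sinh r * -Real.sin θ * partialD 0 g (cylPoint r θ z) +
          Real.sinh r * Real.cos θ * partialD 1 g (cylPoint r θ z)) θ := fun {g} hg r hr θ z => by
    simpa [Fin.sum_univ_three] using hasDerivAt_comp_curve (γ := fun θ => cylPoint r θ z)
      (hg _ (hmem r hr (θ, z))) (hγt r θ z)
  have hdz : ∀ {g : (Fin 3 → ℝ) → ℝ}, (∀ p ∈ tubeCover R, DifferentiableAt ℝ g p) →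
      ∀ r ∈ Ioo (-R) R, ∀ θ z, HasDerivAt (fun z => g (cylPoint r θ z))
        (partialD 2 g (cylPoint r θ z)) z := fun {g} hg r hr θ z => by
    simpa [Fin.sum_univ_three] using hasDerivAt_comp_curve (γ := fun z => cylPoint r θ z)
      (hg _ (hmem r hr (θ, z))) (hγz r θ z)
  refine ⟨fun r x => ((Real.cosh r * Real.cos x.1 * partialD 0 u (cylPoint r x.1 x.2) +
      Real.cosh r * Real.sin x.1 * partialD 1 u (cylPoint r x.1 x.2) : ℝ) : ℂ),
    fun r x => ((Real.sinh r * Real.cos x.1 * partialD 0 u (cylPoint r x.1 x.2) +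
      Real.cosh r * Real.cos x.1 *
        (Real.cosh r * Real.cos x.1 * partialD 0 (partialD 0 u) (cylPoint r x.1 x.2) +
          Real.cosh r * Real.sin x.1 * partialD 1 (partialD 0 u) (cylPoint r x.1 x.2)) +
      (Real.sinh r * Real.sin x.1 * partialD 1 u (cylPoint r x.1 x.2) +
      Real.cosh r * Real.sin x.1 *
        (Real.cosh r * Real.cos x.1 * partialD 0 (partialD 1 u) (cylPoint r x.1 x.2) +
          Real.cosh r * Real.sin x.1 * partialD 1 (partialD 1 u) (cylPoint r x.1 x.2))) : ℝ) : ℂ),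
    fun r x => ((Real.sinh r * -Real.sin x.1 * partialD 0 u (cylPoint r x.1 x.2) +
      Real.sinh r * Real.cos x.1 * partialD 1 u (cylPoint r x.1 x.2) : ℝ) : ℂ),
    fun r x => ((Real.sinh r * -Real.cos x.1 * partialD 0 u (cylPoint r x.1 x.2) +
      Real.sinh r * -Real.sin x.1 *
        (Real.sinh r * -Real.sin x.1 * partialD 0 (partialD 0 u) (cylPoint r x.1 x.2) +
          Real.sinh r * Real.cos x.1 * partialD 1 (partialD 0 u) (cylPoint r x.1 x.2)) +
      (Real.sinh r * -Real.sin x.1 * partialD 1 u (cylPoint r x.1 x.2) +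
      Real.sinh r * Real.cos x.1 *
        (Real.sinh r * -Real.sin x.1 * partialD 0 (partialD 1 u) (cylPoint r x.1 x.2) +
          Real.sinh r * Real.cos x.1 * partialD 1 (partialD 1 u) (cylPoint r x.1 x.2))) : ℝ) : ℂ),
    fun r x => (partialD 2 u (cylPoint r x.1 x.2) : ℂ),
    fun r x => (partialD 2 (partialD 2 u) (cylPoint r x.1 x.2) : ℂ), ?_⟩
  have hcv0 := hcv 0
  have hcv1 := hcv 1
  have h00 := hcw 0 0
  have h01 := hcw 0 1
  have h10 := hcw 1 0
  have h11 := hcw 1 1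
  constructor
  · exact Complex.continuous_ofReal.comp_continuousOn hcu
  · refine Complex.continuous_ofReal.comp_continuousOn ?_
    fun_prop
  · refine Complex.continuous_ofReal.comp_continuousOn ?_
    fun_prop
  · refine Complex.continuous_ofReal.comp_continuousOn ?_
    fun_prop
  · refine Complex.continuous_ofReal.comp_continuousOn ?_
    fun_prop
  · exact Complex.continuous_ofReal.comp_continuousOn (hcv 2)
  · exact Complex.continuous_ofReal.comp_continuousOn (hcw 2 2)
  · exact fun r hr x => (hdr hud r hr x.1 x.2).ofReal_comp
  · exact fun r hr x => ((((Real.hasDerivAt_cosh r).mul_const _).mul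
      (hdr (hv 0) r hr x.1 x.2)).add (((Real.hasDerivAt_cosh r).mul_const _).mul
      (hdr (hv 1) r hr x.1 x.2))).ofReal_comp
  · exact fun r hr θ z => (hdt hud r hr θ z).ofReal_comp
  · exact fun r hr θ z => ((((Real.hasDerivAt_sin θ).neg.const_mul _).mul
      (hdt (hv 0) r hr θ z)).add (((Real.hasDerivAt_cos θ).const_mul _).mul
      (hdt (hv 1) r hr θ z))).ofReal_comp
  · exact fun r hr θ z => (hdz hud r hr θ z).ofReal_comp
  · exact fun r hr θ z => (hdz (hv 2) r hr θ z).ofReal_comp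
  · intro r hr x
    have h := hL _ (hmem r hr x)
    rw [laplaceBeltrami_tubeMetric hs hu (hmem r hr x)] at h
    have hsymm := partialD_comm hs hu (hmem r hr x) 1 0
    rw [hsymm]
    norm_cast
    generalize partialD 0 u (cylPoint r x.1 x.2) = a0 at *
    generalize partialD 1 u (cylPoint r x.1 x.2) = a1 at *
    generalize partialD 0 (partialD 0 u) (cylPoint r x.1 x.2) = b00 at *
    generalize partialD 0 (partialD 1 u) (cylPoint r x.1 x.2) = b01 at *
    generalize partialD 1 (partialD 1 u) (cylPoint r x.1 x.2) = b11 at *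
    generalize partialD 2 (partialD 2 u) (cylPoint r x.1 x.2) = b22 at *
    have hx0 : cylPoint r x.1 x.2 0 = Real.sinh r * Real.cos x.1 := rfl
    have hx1 : cylPoint r x.1 x.2 1 = Real.sinh r * Real.sin x.1 := rfl
    rw [hx0, hx1] at h
    have hc2 : Real.cosh r ^ 2 = 1 + Real.sinh r ^ 2 := by rw [Real.cosh_sq]; ring
    have ht := Real.sin_sq_add_cos_sq x.1
    have hw : 1 + (Real.sinh r * Real.cos x.1) ^ 2 + (Real.sinh r * Real.sin x.1) ^ 2 =
        Real.cosh r ^ 2 := by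
      linear_combination (Real.sinh r ^ 2) * ht - hc2
    rw [hw] at h
    have hne : Real.cosh r ≠ 0 := (Real.cosh_pos r).ne'
    have hinv := inv_mul_cancel₀ (pow_ne_zero 2 hne)
    generalize Real.cosh r = C at *
    generalize Real.sinh r = S at *
    generalize Real.cos x.1 = c at *
    generalize Real.sin x.1 = s at *
    -- The Laplace equation is multiplied by `sinh² r cosh² r`, which removes every denominator,
    -- including the singularity of polar coordinates at the core.
    linear_combination S ^ 2 * C ^ 2 * h +
      hc2 * (S * C ^ 2 * (c * a0 + s * a1) +
        S ^ 2 * C ^ 2 * (c ^ 2 * b00 + 2 * c * s * b01 + s ^ 2 * b11)) +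
      ht * (S ^ 2 * C ^ 2 * (b00 + b11)) - S ^ 2 * b22 * hinv
  · intro r _ θ z
    simp [cylPoint]
  · intro r hr θ z
    -- The screw motion lowers the angle by `θ₀`, so it is applied at `(θ + θ₀, z)` to land on `(θ,
    -- z + ℓ)`.
    have h := tubeLift_tubeDeck f 1 (hmem r hr (θ + θ₀, z)) (by
      rw [tubeDeck_cylPoint]; exact cylPoint_mem_tubeCover_of_mem_Ioo hr _ _)
    rw [tubeDeck_cylPoint] at h
    simp only [Int.cast_one, one_mul, add_sub_cancel_right] at h
    simpa using h

/-! ### The radial series as a function of `r` -/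

theorem Real.hasDerivAt_tanh_one_sub_sq (r : ℝ) : HasDerivAt Real.tanh (1 - Real.tanh r ^ 2) r := by
  have hc := (Real.cosh_pos r).ne'
  have h := (Real.hasDerivAt_sinh r).div (Real.hasDerivAt_cosh r) hc
  have hfun : Real.tanh = fun r => Real.sinh r / Real.cosh r := funext Real.tanh_eq_sinh_div_cosh
  rw [hfun]
  refine h.congr_deriv ?_
  field_simp

/-- For `t = tanh r` one has `dt/dr = 1 - t² = 1 / cosh² r`, hence `sinh r cosh r d/dr = t d/dt`. -/
theorem exists_hasDerivAt_radialSeries_tanh (k : ℕ) (ν : ℝ) (j : ℕ) (r : ℝ) :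
    ∃ d, HasDerivAt (fun r => radialSeries k ν j (Real.tanh r)) d r ∧
      Real.sinh r * Real.cosh r * d = radialSeries k ν (j + 1) (Real.tanh r) := by
  obtain ⟨d, hd, h⟩ := hasDerivAt_radialSeries k ν j (Real.abs_tanh_lt_one r)
  refine ⟨_, hd.comp r (Real.hasDerivAt_tanh_one_sub_sq r), ?_⟩
  rw [← h, Real.tanh_eq_sinh_div_cosh]
  have hc := (Real.cosh_pos r).ne'
  field_simp
  rw [Real.cosh_sq]
  ring

/-! ### Fourier modes on the twisted torus -/

/-- The Fourier character of frequencies `k` and `ν` in `θ` and `z`. -/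
noncomputable def cylChar (k : ℕ) (ν : ℝ) (x : ℝ × ℝ) : ℂ :=
  Complex.exp (-(k * x.1 + ν * x.2 : ℝ) * Complex.I)

/-- A fundamental domain of the `(θ, z)`-torus. -/
def cylBox (ℓ : ℝ) : Set (ℝ × ℝ) := Icc 0 (2 * Real.pi) ×ˢ Icc 0 ℓ

/-- The unnormalised Fourier coefficient of a function of `(θ, z)`. -/
noncomputable def cylMode (ℓ : ℝ) (k : ℕ) (ν : ℝ) (F : ℝ × ℝ → ℂ) : ℂ :=
  ∫ x in cylBox ℓ, F x * cylChar k ν x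

theorem isCompact_cylBox (ℓ : ℝ) : IsCompact (cylBox ℓ) := isCompact_Icc.prod isCompact_Icc

theorem measurableSet_cylBox (ℓ : ℝ) : MeasurableSet (cylBox ℓ) :=
  measurableSet_Icc.prod measurableSet_Icc

theorem continuous_cylChar (k : ℕ) (ν : ℝ) : Continuous (cylChar k ν) := by
  unfold cylChar
  fun_prop

theorem norm_cylChar (k : ℕ) (ν : ℝ) (x : ℝ × ℝ) : ‖cylChar k ν x‖ = 1 := by
  rw [cylChar, ← Complex.ofReal_neg, Complex.norm_exp_ofReal_mul_I]

theorem integrableOn_cylBox (ℓ : ℝ) {F : ℝ × ℝ → ℂ} (hF : Continuous F) :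
    IntegrableOn F (cylBox ℓ) :=
  hF.continuousOn.integrableOn_compact (isCompact_cylBox ℓ)

/-- Both orders of integration are used: this one puts `z` innermost for integration by parts in
`z`, the next one puts `θ` innermost. -/
theorem setIntegral_cylBox {ℓ : ℝ} (hℓ : 0 < ℓ) {F : ℝ × ℝ → ℂ} (hF : Continuous F) :
    ∫ x in cylBox ℓ, F x = ∫ θ in (0 : ℝ)..2 * Real.pi, ∫ z in (0 : ℝ)..ℓ, F (θ, z) := by
  have h := setIntegral_prod F (integrableOn_cylBox ℓ hF)
  rw [Measure.volume_eq_prod]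
  refine h.trans ?_
  rw [intervalIntegral.integral_of_le Real.two_pi_pos.le, integral_Icc_eq_integral_Ioc]
  simp_rw [intervalIntegral.integral_of_le hℓ.le, integral_Icc_eq_integral_Ioc]

theorem setIntegral_cylBox' {ℓ : ℝ} (hℓ : 0 < ℓ) {F : ℝ × ℝ → ℂ} (hF : Continuous F) :
    ∫ x in cylBox ℓ, F x = ∫ z in (0 : ℝ)..ℓ, ∫ θ in (0 : ℝ)..2 * Real.pi, F (θ, z) := by
  have hs : Continuous fun x : ℝ × ℝ => F x.swap := hF.comp continuous_swap
  have h := setIntegral_prod (fun x : ℝ × ℝ => F x.swap) (s := Icc 0 ℓ)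
    (t := Icc 0 (2 * Real.pi)) (μ := volume) (ν := volume)
    (hs.continuousOn.integrableOn_compact (isCompact_Icc.prod isCompact_Icc))
  have h2 := setIntegral_prod_swap (Icc 0 (2 * Real.pi)) (Icc 0 ℓ) F (μ := volume) (ν := volume)
  rw [cylBox, Measure.volume_eq_prod, ← h2, h]
  rw [intervalIntegral.integral_of_le hℓ.le, integral_Icc_eq_integral_Ioc]
  simp_rw [intervalIntegral.integral_of_le Real.two_pi_pos.le, integral_Icc_eq_integral_Ioc]
  rfl

theorem norm_cylMode_le (ℓ : ℝ) (k : ℕ) (ν : ℝ) {F : ℝ × ℝ → ℂ} {C : ℝ}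
    (hC : ∀ x ∈ cylBox ℓ, ‖F x‖ ≤ C) :
    ‖cylMode ℓ k ν F‖ ≤ C * volume.real (cylBox ℓ) :=
  norm_setIntegral_le_of_norm_le_const (isCompact_cylBox ℓ).measure_lt_top fun x hx => by
    rw [norm_mul, norm_cylChar, mul_one]; exact hC x hx

theorem hasDerivAt_cylChar_fst (k : ℕ) (ν θ z : ℝ) :
    HasDerivAt (fun t => cylChar k ν (t, z)) (-(k * Complex.I) * cylChar k ν (θ, z)) θ := by
  have h : HasDerivAt (fun t : ℝ => -((k * t + ν * z : ℝ) : ℂ) * Complex.I)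
      (-((k * 1 : ℝ) : ℂ) * Complex.I) θ :=
    ((((hasDerivAt_id θ).const_mul (k : ℝ)).add_const (ν * z)).ofReal_comp.neg).mul_const _
  refine h.cexp.congr_deriv ?_
  simp only [cylChar]
  push_cast
  ring

theorem hasDerivAt_cylChar_snd (k : ℕ) (ν θ z : ℝ) :
    HasDerivAt (fun t => cylChar k ν (θ, t)) (-(ν * Complex.I) * cylChar k ν (θ, z)) z := by
  have h : HasDerivAt (fun t : ℝ => -((k * θ + ν * t : ℝ) : ℂ) * Complex.I)
      (-((ν * 1 : ℝ) : ℂ) * Complex.I) z :=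
    ((((hasDerivAt_id z).const_mul ν).const_add (k * θ : ℝ)).ofReal_comp.neg).mul_const _
  refine h.cexp.congr_deriv ?_
  simp only [cylChar]
  push_cast
  ring

theorem cylChar_periodic (k : ℕ) (ν θ z : ℝ) :
    cylChar k ν (θ + 2 * Real.pi, z) = cylChar k ν (θ, z) := by
  refine Complex.exp_eq_exp_iff_exists_int.2 ⟨-k, ?_⟩
  push_cast
  ring

/-- The frequencies are chosen so that `νℓ = 2πm + kθ₀`; the character then has the same twist as
the lifted function. -/
theorem cylChar_twist {ℓ : ℝ} (hℓ : ℓ ≠ 0) (θ₀ : ℝ) (k : ℕ) (m : ℤ) (θ z : ℝ) :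
    cylChar k (coreFreq ℓ θ₀ k m) (θ, z + ℓ) = cylChar k (coreFreq ℓ θ₀ k m) (θ + θ₀, z) := by
  refine Complex.exp_eq_exp_iff_exists_int.2 ⟨-m, ?_⟩
  have h : coreFreq ℓ θ₀ k m * ℓ = 2 * Real.pi * m + k * θ₀ := by
    rw [coreFreq]; field_simp
  have h' : ((coreFreq ℓ θ₀ k m : ℝ) : ℂ) * ℓ = 2 * Real.pi * m + k * θ₀ := by exact_mod_cast h
  push_cast
  linear_combination (-Complex.I) * h'

/-! ### The radial equation for the modes -/

namespace IsCylHarmonic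

variable {R ℓ θ₀ : ℝ} {U Ur Urr Ut Utt Uz Uzz : ℝ → ℝ × ℝ → ℂ}

theorem continuous_slice {G : ℝ → ℝ × ℝ → ℂ}
    (hG : ContinuousOn (Function.uncurry G) (Ioo (-R) R ×ˢ univ)) {r : ℝ} (hr : r ∈ Ioo (-R) R) :
    Continuous (G r) :=
  hG.comp_continuous (f := fun x => (r, x)) (by fun_prop) fun x => ⟨hr, mem_univ x⟩

theorem hasDerivAt_cylMode {G G' : ℝ → ℝ × ℝ → ℂ}
    (hG : ContinuousOn (Function.uncurry G) (Ioo (-R) R ×ˢ univ))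
    (hG' : ContinuousOn (Function.uncurry G') (Ioo (-R) R ×ˢ univ))
    (hd : ∀ r ∈ Ioo (-R) R, ∀ x, HasDerivAt (G · x) (G' r x) r) (k : ℕ) (ν : ℝ) {r : ℝ}
    (hr : r ∈ Ioo (-R) R) :
    HasDerivAt (fun r => cylMode ℓ k ν (G r)) (cylMode ℓ k ν (G' r)) r := by
  have hch : ContinuousOn (fun q : ℝ × ℝ × ℝ => cylChar k ν q.2) (Ioo (-R) R ×ˢ cylBox ℓ) :=
    ((continuous_cylChar k ν).comp continuous_snd).continuousOn
  have hsub : Ioo (-R) R ×ˢ cylBox ℓ ⊆ Ioo (-R) R ×ˢ univ := prod_mono subset_rfl (subset_univ _)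
  exact hasDerivAt_setIntegral_of_continuousOn (F := fun r x => G r x * cylChar k ν x)
    (F' := fun r x => G' r x * cylChar k ν x) (isCompact_cylBox ℓ) (measurableSet_cylBox ℓ)
    isOpen_Ioo ((hG.mono hsub).mul hch) ((hG'.mono hsub).mul hch)
    (fun r hr x _ => (hd r hr x).mul_const _) hr

theorem periodic_t (h : IsCylHarmonic R ℓ θ₀ U Ur Urr Ut Utt Uz Uzz) {r : ℝ}
    (hr : r ∈ Ioo (-R) R) (θ z : ℝ) : Ut r (θ + 2 * Real.pi, z) = Ut r (θ, z) := by
  have h1 := (h.deriv_t r hr (θ + 2 * Real.pi) z).comp_add_const θ (2 * Real.pi)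
  simp only [h.periodic r hr] at h1
  exact h1.unique (h.deriv_t r hr θ z)

theorem periodic_z (h : IsCylHarmonic R ℓ θ₀ U Ur Urr Ut Utt Uz Uzz) {r : ℝ}
    (hr : r ∈ Ioo (-R) R) (θ z : ℝ) : Uz r (θ + 2 * Real.pi, z) = Uz r (θ, z) := by
  have h1 := h.deriv_z r hr (θ + 2 * Real.pi) z
  simp only [h.periodic r hr] at h1
  exact h1.unique (h.deriv_z r hr θ z)

theorem twist_z (h : IsCylHarmonic R ℓ θ₀ U Ur Urr Ut Utt Uz Uzz) {r : ℝ}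
    (hr : r ∈ Ioo (-R) R) (θ z : ℝ) : Uz r (θ, z + ℓ) = Uz r (θ + θ₀, z) := by
  have h1 := (h.deriv_z r hr θ (z + ℓ)).comp_add_const z ℓ
  simp only [h.twist r hr] at h1
  exact h1.unique (h.deriv_z r hr (θ + θ₀) z)

theorem cylMode_tt (h : IsCylHarmonic R ℓ θ₀ U Ur Urr Ut Utt Uz Uzz) (hℓ : 0 < ℓ) (k : ℕ) (ν : ℝ)
    {r : ℝ} (hr : r ∈ Ioo (-R) R) : cylMode ℓ k ν (Utt r) = -k ^ 2 * cylMode ℓ k ν (U r) := by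
  have hU := continuous_slice h.cont hr
  have hUtt := continuous_slice h.cont_tt hr
  have hch := continuous_cylChar k ν
  have h1 : ∫ x in cylBox ℓ, (Utt r x * cylChar k ν x + k ^ 2 * (U r x * cylChar k ν x)) = 0 := by
    rw [setIntegral_cylBox' hℓ (by fun_prop)]
    refine intervalIntegral.integral_zero_ae (ae_of_all _ fun z _ => ?_)
    -- Two integrations by parts at once: `(U_θ + ikU) χ` is a periodic primitive of `(U_θθ + k²U)
    -- χ`, where `χ` is the character.
    have hd : ∀ θ, HasDerivAt
        (fun θ => (Ut r (θ, z) + k * Complex.I * U r (θ, z)) * cylChar k ν (θ, z))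
        (Utt r (θ, z) * cylChar k ν (θ, z) + k ^ 2 * (U r (θ, z) * cylChar k ν (θ, z))) θ := by
      intro θ
      refine (((h.deriv_tt r hr θ z).add ((h.deriv_t r hr θ z).const_mul _)).mul
        (hasDerivAt_cylChar_fst k ν θ z)).congr_deriv ?_
      simp only [Pi.add_apply]
      linear_combination (-k ^ 2 * U r (θ, z) * cylChar k ν (θ, z)) * Complex.I_sq
    rw [intervalIntegral.integral_eq_sub_of_hasDerivAt (fun θ _ => hd θ)
      (Continuous.intervalIntegrable (by fun_prop) _ _)]
    have hp1 := h.periodic r hr 0 z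
    have hp2 := h.periodic_t hr 0 z
    have hp3 := cylChar_periodic k ν 0 z
    rw [zero_add] at hp1 hp2 hp3
    rw [hp1, hp2, hp3, sub_self]
  rw [integral_add (integrableOn_cylBox ℓ (by fun_prop)) (integrableOn_cylBox ℓ (by fun_prop)),
    integral_const_mul] at h1
  rw [cylMode, cylMode]
  linear_combination h1

/-- The boundary terms in `z` do not cancel pointwise: by the twist they differ by the rotation `θ ↦
θ + θ₀`. Their difference vanishes after integration over a full period in `θ`. -/
theorem cylMode_zz (h : IsCylHarmonic R ℓ θ₀ U Ur Urr Ut Utt Uz Uzz) (hℓ : 0 < ℓ) (k : ℕ) (m : ℤ)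
    {r : ℝ} (hr : r ∈ Ioo (-R) R) : cylMode ℓ k (coreFreq ℓ θ₀ k m) (Uzz r) =
      -(coreFreq ℓ θ₀ k m : ℂ) ^ 2 * cylMode ℓ k (coreFreq ℓ θ₀ k m) (U r) := by
  have hU := continuous_slice h.cont hr
  have hUz := continuous_slice h.cont_z hr
  have hUzz := continuous_slice h.cont_zz hr
  have htw := cylChar_twist hℓ.ne' θ₀ k m
  generalize coreFreq ℓ θ₀ k m = ν at *
  have hch := continuous_cylChar k ν
  have h1 : ∫ x in cylBox ℓ, (Uzz r x * cylChar k ν x + ν ^ 2 * (U r x * cylChar k ν x)) = 0 := by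
    rw [setIntegral_cylBox hℓ (by fun_prop)]
    set H : ℝ → ℝ → ℂ := fun θ z =>
      (Uz r (θ, z) + ν * Complex.I * U r (θ, z)) * cylChar k ν (θ, z) with hH
    have hd : ∀ θ z, HasDerivAt (H θ)
        (Uzz r (θ, z) * cylChar k ν (θ, z) + ν ^ 2 * (U r (θ, z) * cylChar k ν (θ, z))) z := by
      intro θ z
      refine (((h.deriv_zz r hr θ z).add ((h.deriv_z r hr θ z).const_mul _)).mul
        (hasDerivAt_cylChar_snd k ν θ z)).congr_deriv ?_
      simp only [Pi.add_apply]
      linear_combination (-ν ^ 2 * U r (θ, z) * cylChar k ν (θ, z)) * Complex.I_sq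
    have hper : Function.Periodic (fun θ => H θ 0) (2 * Real.pi) := by
      intro θ
      simp only [hH, h.periodic r hr, h.periodic_z hr, cylChar_periodic]
    have hcont : Continuous fun θ => H θ 0 := by fun_prop
    have hstep : ∀ θ, ∫ z in (0 : ℝ)..ℓ, (Uzz r (θ, z) * cylChar k ν (θ, z) +
        ν ^ 2 * (U r (θ, z) * cylChar k ν (θ, z))) = H (θ + θ₀) 0 - H θ 0 := by
      intro θ
      rw [intervalIntegral.integral_eq_sub_of_hasDerivAt (fun z _ => hd θ z)
        (Continuous.intervalIntegrable (by fun_prop) _ _)]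
      have hp1 := h.twist r hr θ 0
      have hp2 := h.twist_z hr θ 0
      have hp3 := htw θ 0
      rw [zero_add] at hp1 hp2 hp3
      simp only [hH]
      rw [hp1, hp2, hp3]
    simp_rw [hstep]
    have hcont' : Continuous fun θ => H (θ + θ₀) 0 := by fun_prop
    rw [intervalIntegral.integral_sub (hcont'.intervalIntegrable _ _)
      (hcont.intervalIntegrable _ _),
      intervalIntegral.integral_comp_add_right (fun θ => H θ 0), sub_eq_zero, zero_add,
      add_comm (2 * Real.pi), hper.intervalIntegral_add_eq θ₀ 0, zero_add]
  rw [integral_add (integrableOn_cylBox ℓ (by fun_prop)) (integrableOn_cylBox ℓ (by fun_prop)),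
    integral_const_mul] at h1
  rw [cylMode, cylMode]
  linear_combination h1

theorem cylMode_laplace (h : IsCylHarmonic R ℓ θ₀ U Ur Urr Ut Utt Uz Uzz) (hℓ : 0 < ℓ) (k : ℕ)
    (m : ℤ) {r : ℝ} (hr : r ∈ Ioo (-R) R) :
    (Real.sinh r * Real.cosh r * (Real.cosh r ^ 2 + Real.sinh r ^ 2) : ℝ) *
        cylMode ℓ k (coreFreq ℓ θ₀ k m) (Ur r) +
      (Real.sinh r ^ 2 * Real.cosh r ^ 2 : ℝ) * cylMode ℓ k (coreFreq ℓ θ₀ k m) (Urr r) =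
    (Real.cosh r ^ 2 * k ^ 2 + Real.sinh r ^ 2 * coreFreq ℓ θ₀ k m ^ 2 : ℝ) *
      cylMode ℓ k (coreFreq ℓ θ₀ k m) (U r) := by
  have ht := h.cylMode_tt hℓ k (coreFreq ℓ θ₀ k m) hr
  have hz := h.cylMode_zz hℓ k m hr
  have hch := continuous_cylChar k (coreFreq ℓ θ₀ k m)
  have hint : ∀ {G : ℝ → ℝ × ℝ → ℂ} (c : ℂ),
      ContinuousOn (Function.uncurry G) (Ioo (-R) R ×ˢ univ) →
      IntegrableOn (fun x => c * (G r x * cylChar k (coreFreq ℓ θ₀ k m) x)) (cylBox ℓ) := by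
    intro G c hG
    have := continuous_slice hG hr
    exact integrableOn_cylBox ℓ (by fun_prop)
  have h0 : ∫ x in cylBox ℓ, (((Real.sinh r * Real.cosh r *
      (Real.cosh r ^ 2 + Real.sinh r ^ 2) : ℝ) : ℂ) * (Ur r x * cylChar k (coreFreq ℓ θ₀ k m) x) +
      ((Real.sinh r ^ 2 * Real.cosh r ^ 2 : ℝ) : ℂ) *
        (Urr r x * cylChar k (coreFreq ℓ θ₀ k m) x) +
      ((Real.cosh r ^ 2 : ℝ) : ℂ) * (Utt r x * cylChar k (coreFreq ℓ θ₀ k m) x) +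
      ((Real.sinh r ^ 2 : ℝ) : ℂ) * (Uzz r x * cylChar k (coreFreq ℓ θ₀ k m) x)) = 0 := by
    refine (setIntegral_congr_fun (measurableSet_cylBox ℓ) fun x _ => ?_).trans
      (integral_zero _ _)
    linear_combination cylChar k (coreFreq ℓ θ₀ k m) x * h.laplace r hr x
  rw [integral_add (((hint _ h.cont_r).fun_add (hint _ h.cont_rr)).fun_add (hint _ h.cont_tt))
    (hint _ h.cont_zz), integral_add ((hint _ h.cont_r).fun_add (hint _ h.cont_rr))
    (hint _ h.cont_tt), integral_add (hint _ h.cont_r) (hint _ h.cont_rr)] at h0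
  simp only [integral_const_mul] at h0
  simp only [cylMode] at ht hz ⊢
  rw [ht, hz] at h0
  push_cast at h0 ⊢
  linear_combination h0

end IsCylHarmonic

/-! ### Summability over the frequencies -/

theorem Real.tanh_strictMono : StrictMono Real.tanh :=
  strictMono_of_deriv_pos fun r => by
    rw [(Real.hasDerivAt_tanh_one_sub_sq r).deriv]
    linarith [Real.tanh_sq_lt_one r]

theorem summable_one_div_one_add_sq : Summable fun m : ℤ => 1 / (1 + (m : ℝ) ^ 2) := by
  have h1 : Summable fun m : ℤ => 1 / (m : ℝ) ^ 2 := Real.summable_one_div_int_pow.2 one_lt_two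
  -- At `m = 0` the term `1 / m ^ 2` is `0` by convention, so the value `1` has to be supplied
  -- separately.
  have h2 : Summable fun m : ℤ => if m = 0 then (1 : ℝ) else 0 := (hasSum_ite_eq 0 1).summable
  refine Summable.of_nonneg_of_le (fun m => by positivity) (fun m => ?_) (h1.add h2)
  rcases eq_or_ne m 0 with rfl | hm
  · simp
  · have : (0 : ℝ) < (m : ℝ) ^ 2 := by positivity
    rw [if_neg hm, add_zero]
    exact one_div_le_one_div_of_le this (by linarith)

/-- Since `ν = (2π/ℓ)(m + ks)`, the shift by `ks` is removed by Peetre's inequality `1 + m² ≤ 2 (1 +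
(m + ks)²)(1 + (ks)²)`. Its cost is quadratic in `k` and is absorbed by `q ^ k`, leaving a product
of two convergent series. -/
theorem summable_pow_div_one_add_coreFreq_sq {ℓ : ℝ} (hℓ : 0 < ℓ) (θ₀ : ℝ) {q : ℝ} (h0 : 0 ≤ q)
    (h1 : q < 1) :
    Summable fun km : ℕ × ℤ => q ^ km.1 / (1 + coreFreq ℓ θ₀ km.1 km.2 ^ 2) := by
  set s := θ₀ / (2 * Real.pi) with hs
  set δ := min 1 ((2 * Real.pi / ℓ) ^ 2) with hδ
  have hδ0 : 0 < δ := lt_min one_pos (by positivity)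
  have hk : Summable fun k : ℕ => q ^ k * (1 + (k * s) ^ 2) := by
    have hg := summable_geometric_of_lt_one h0 h1
    have hg2 := summable_pow_mul_geometric_of_norm_lt_one (R := ℝ) 2
      (by rwa [Real.norm_of_nonneg h0] : ‖q‖ < 1)
    exact (hg.add (hg2.mul_left (s ^ 2))).congr fun k => by ring
  have hprod := (hk.mul_of_nonneg summable_one_div_one_add_sq (fun k => by positivity)
    (fun m => by positivity)).mul_left (2 / δ)
  refine Summable.of_nonneg_of_le (fun km => by positivity) (fun ⟨k, m⟩ => ?_) hprod
  have hν : coreFreq ℓ θ₀ k m = 2 * Real.pi / ℓ * (m + k * s) := by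
    rw [coreFreq, hs]; field_simp
  have h2 : δ * (1 + (m + k * s) ^ 2) ≤ 1 + coreFreq ℓ θ₀ k m ^ 2 := by
    rw [hν, mul_pow]
    have ha : δ ≤ 1 := min_le_left _ _
    have hb : δ ≤ (2 * Real.pi / ℓ) ^ 2 := min_le_right _ _
    nlinarith [mul_le_mul_of_nonneg_right hb (sq_nonneg ((m : ℝ) + k * s))]
  have h3 : 1 + (m : ℝ) ^ 2 ≤ 2 * (1 + (m + k * s) ^ 2) * (1 + (k * s) ^ 2) := by
    nlinarith [sq_nonneg ((m : ℝ) + 2 * (k * s)), sq_nonneg (((m : ℝ) + k * s) * (k * s))]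
  calc q ^ k / (1 + coreFreq ℓ θ₀ k m ^ 2) ≤ q ^ k / (δ * (1 + (m + k * s) ^ 2)) := by gcongr
    _ ≤ 2 / δ * (q ^ k * (1 + (k * s) ^ 2) * (1 / (1 + (m : ℝ) ^ 2))) := by
      rw [div_le_iff₀ (by positivity)]
      have h4 : 1 ≤ 2 * (1 + (m + k * s) ^ 2) * (1 + (k * s) ^ 2) * (1 / (1 + (m : ℝ) ^ 2)) := by
        rw [mul_one_div, one_le_div (by positivity)]; exact h3
      calc q ^ k = q ^ k * 1 := (mul_one _).symm
        _ ≤ q ^ k * (2 * (1 + (m + k * s) ^ 2) * (1 + (k * s) ^ 2) * (1 / (1 + (m : ℝ) ^ 2))) := by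
          gcongr
        _ = _ := by field_simp

/-! ### Modes as multiples of the radial series, and their decay -/

namespace IsCylHarmonic

variable {R ℓ θ₀ : ℝ} {U Ur Urr Ut Utt Uz Uzz : ℝ → ℝ × ℝ → ℂ}

/-- The Wronskian of a Fourier coefficient and the radial series vanishes. -/
theorem wronskian_eq_zero (h : IsCylHarmonic R ℓ θ₀ U Ur Urr Ut Utt Uz Uzz) (hℓ : 0 < ℓ)
    (k : ℕ) (m : ℤ) {r : ℝ} (hr : r ∈ Ioo 0 R) :
    (Real.sinh r * Real.cosh r : ℝ) * cylMode ℓ k (coreFreq ℓ θ₀ k m) (Ur r) *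
        (radialSeries k (coreFreq ℓ θ₀ k m) 0 (Real.tanh r) : ℝ) -
      cylMode ℓ k (coreFreq ℓ θ₀ k m) (U r) *
        (radialSeries k (coreFreq ℓ θ₀ k m) 1 (Real.tanh r) : ℝ) = 0 := by
  have hode := fun r hr => h.cylMode_laplace hℓ k m (r := r) hr
  generalize coreFreq ℓ θ₀ k m = ν at *
  have hR : 0 < R := hr.1.trans hr.2
  have hc := fun r hr => hasDerivAt_cylMode (ℓ := ℓ) h.cont h.cont_r h.deriv_r k ν (r := r) hr
  have hcr := fun r hr => hasDerivAt_cylMode (ℓ := ℓ) h.cont_r h.cont_rr h.deriv_rr k ν (r := r) hr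
  choose d0 hd0 hd0' using exists_hasDerivAt_radialSeries_tanh k ν 0
  choose d1 hd1 hd1' using exists_hasDerivAt_radialSeries_tanh k ν 1
  have hsc : ∀ r, HasDerivAt (fun r => ((Real.sinh r * Real.cosh r : ℝ) : ℂ))
      ((Real.cosh r * Real.cosh r + Real.sinh r * Real.sinh r : ℝ) : ℂ) r :=
    fun r => ((Real.hasDerivAt_sinh r).mul (Real.hasDerivAt_cosh r)).ofReal_comp
  set W : ℝ → ℂ := fun r => (Real.sinh r * Real.cosh r : ℝ) * cylMode ℓ k ν (Ur r) *
    (radialSeries k ν 0 (Real.tanh r) : ℝ) - cylMode ℓ k ν (U r) *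
      (radialSeries k ν 1 (Real.tanh r) : ℝ) with hW
  have hWd : ∀ r ∈ Ioo (-R) R, HasDerivAt W _ r := fun r hr =>
    ((((hsc r).mul (hcr r hr)).mul (hd0 r).ofReal_comp).sub ((hc r hr).mul (hd1 r).ofReal_comp))
  have hsub : Ioo 0 R ⊆ Ioo (-R) R := Ioo_subset_Ioo_left (by linarith)
  -- Regularity at the core enters here: both terms of the Wronskian contain `D`, which vanishes at
  -- `r = 0`.
  have hW0 : W 0 = 0 := by
    have h1 : radialSeries k ν 1 (Real.tanh 0) = 0 := by rw [← hd0' 0]; simp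
    simp only [hW, h1]
    simp
  -- Multiplied by `sinh r cosh r`, the derivative of `W` is `D²c · Φ - c · D²Φ`, zero because `c`
  -- and `Φ` solve the same equation. The factor can be cancelled only for `r > 0`; continuity at
  -- `0` then fixes the constant.
  obtain ⟨a, ha⟩ := isOpen_Ioo.exists_is_const_of_deriv_eq_zero (isPreconnected_Ioo (a := 0) (b := R))
    (f := W) (fun r hr => (hWd r (hsub hr)).differentiableAt.differentiableWithinAt)
    (fun r hr => by
      have hs : Real.sinh r ≠ 0 := (Real.sinh_pos_iff.2 hr.1).ne'
      have hch : Real.cosh r ≠ 0 := (Real.cosh_pos r).ne'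
      have hsc0 : ((Real.sinh r * Real.cosh r : ℝ) : ℂ) ≠ 0 := by
        exact_mod_cast mul_ne_zero hs hch
      rw [(hWd r (hsub hr)).deriv]
      refine mul_left_cancel₀ hsc0 ?_
      have ho := hode r (hsub hr)
      have hser := radialSeries_ode k ν (Real.abs_tanh_lt_one r)
      have hser' : radialSeries k ν 2 (Real.tanh r) =
          (Real.cosh r ^ 2 * k ^ 2 + Real.sinh r ^ 2 * ν ^ 2) *
            radialSeries k ν 0 (Real.tanh r) := by
        have h2 : (Real.cosh r) ^ 2 * (1 - Real.tanh r ^ 2) = 1 := by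
          rw [Real.tanh_eq_sinh_div_cosh]; field_simp; rw [Real.cosh_sq]; ring
        have h3 : (Real.cosh r) ^ 2 * Real.tanh r ^ 2 = Real.sinh r ^ 2 := by
          rw [Real.tanh_eq_sinh_div_cosh]; field_simp
        linear_combination Real.cosh r ^ 2 * hser - radialSeries k ν 2 (Real.tanh r) * h2 +
          ν ^ 2 * radialSeries k ν 0 (Real.tanh r) * h3
      have e0 := congrArg (Complex.ofReal) (hd0' r)
      have e1 := congrArg (Complex.ofReal) ((hd1' r).trans hser')
      simp only [Pi.zero_apply, Pi.mul_apply, mul_zero]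
      push_cast at ho e0 e1 ⊢
      linear_combination (radialSeries k ν 0 (Real.tanh r) : ℂ) * ho +
        Complex.sinh r * Complex.cosh r * cylMode ℓ k ν (Ur r) * e0 - cylMode ℓ k ν (U r) * e1)
  have hlim1 : Tendsto W (𝓝[>] 0) (𝓝 (W 0)) :=
    (hWd 0 ⟨by linarith, hR⟩).continuousAt.tendsto.mono_left nhdsWithin_le_nhds
  have hlim2 : Tendsto W (𝓝[>] 0) (𝓝 a) := by
    refine tendsto_const_nhds.congr' ?_
    filter_upwards [Ioo_mem_nhdsGT hR] with s hs using (ha s hs).symm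
  have := tendsto_nhds_unique hlim1 hlim2
  rw [← hW0, this]
  exact ha r hr

/-- The numerator of `(c / Φ)'` is the Wronskian up to the factor `sinh r cosh r`, and `Φ > 0` for
`r > 0`, so the quotient is constant. -/
theorem exists_cylMode_eq (h : IsCylHarmonic R ℓ θ₀ U Ur Urr Ut Utt Uz Uzz) (hR : 0 < R)
    (hℓ : 0 < ℓ) (k : ℕ) (m : ℤ) : ∃ α : ℂ, ∀ r ∈ Ico 0 R,
      cylMode ℓ k (coreFreq ℓ θ₀ k m) (U r) =
        α * (radialSeries k (coreFreq ℓ θ₀ k m) 0 (Real.tanh r) : ℝ) := by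
  have hw := fun r hr => h.wronskian_eq_zero hℓ k m (r := r) hr
  generalize coreFreq ℓ θ₀ k m = ν at *
  have hc := fun r hr => hasDerivAt_cylMode (ℓ := ℓ) h.cont h.cont_r h.deriv_r k ν (r := r) hr
  choose d0 hd0 hd0' using exists_hasDerivAt_radialSeries_tanh k ν 0
  have hsub : Ioo 0 R ⊆ Ioo (-R) R := Ioo_subset_Ioo_left (by linarith)
  have hpos : ∀ r ∈ Ioo 0 R, ((radialSeries k ν 0 (Real.tanh r) : ℝ) : ℂ) ≠ 0 := fun r hr => by
    have := Real.tanh_strictMono hr.1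
    rw [Real.tanh_zero] at this
    exact_mod_cast (radialSeries_pos k ν this (Real.tanh_lt_one r)).ne'
  have hQ : ∀ r ∈ Ioo 0 R, HasDerivAt
      (fun r => cylMode ℓ k ν (U r) / (radialSeries k ν 0 (Real.tanh r) : ℝ)) _ r := fun r hr =>
    (hc r (hsub hr)).div (hd0 r).ofReal_comp (hpos r hr)
  obtain ⟨a, ha⟩ := isOpen_Ioo.exists_is_const_of_deriv_eq_zero (isPreconnected_Ioo (a := 0) (b := R))
    (fun r hr => (hQ r hr).differentiableAt.differentiableWithinAt)
    (fun r hr => by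
      have hsc0 : ((Real.sinh r * Real.cosh r : ℝ) : ℂ) ≠ 0 := by
        exact_mod_cast mul_ne_zero (Real.sinh_pos_iff.2 hr.1).ne' (Real.cosh_pos r).ne'
      rw [(hQ r hr).deriv, Pi.zero_apply, div_eq_zero_iff]
      left
      refine mul_left_cancel₀ hsc0 ?_
      have e0 := congrArg (Complex.ofReal) (hd0' r)
      have e1 := hw r hr
      push_cast at e0 e1 ⊢
      linear_combination e1 - cylMode ℓ k ν (U r) * e0)
  have heq : ∀ r ∈ Ioo 0 R,
      cylMode ℓ k ν (U r) = a * (radialSeries k ν 0 (Real.tanh r) : ℝ) := fun r hr => by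
    rw [← ha r hr, div_mul_cancel₀ _ (hpos r hr)]
  refine ⟨a, fun r hr => ?_⟩
  -- At the core `Φ` may vanish, so the identity is obtained there as a limit.
  rcases hr.1.eq_or_lt with rfl | h0
  · refine tendsto_nhds_unique_of_eventuallyEq (l := 𝓝[>] (0 : ℝ))
      ((hc 0 ⟨by linarith, hR⟩).continuousAt.tendsto.mono_left nhdsWithin_le_nhds)
      (((hd0 0).ofReal_comp.continuousAt.tendsto.mono_left nhdsWithin_le_nhds).const_mul a) ?_
    filter_upwards [Ioo_mem_nhdsGT hR] with s hs using heq s hs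
  · exact heq r ⟨h0, hr.2⟩

/-- The mode of `U_zz` is `-ν²` times that of `U`, and characters have modulus one, so sup bounds of
`U` and `U_zz` on the box control `(1 + ν²)|c|` for all `k` and `m` together. -/
theorem exists_norm_cylMode_le (h : IsCylHarmonic R ℓ θ₀ U Ur Urr Ut Utt Uz Uzz) (hℓ : 0 < ℓ)
    {r : ℝ} (hr : r ∈ Ioo (-R) R) : ∃ C, 0 ≤ C ∧ ∀ (k : ℕ) (m : ℤ),
      ‖cylMode ℓ k (coreFreq ℓ θ₀ k m) (U r)‖ ≤ C / (1 + coreFreq ℓ θ₀ k m ^ 2) := by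
  obtain ⟨A, hA⟩ := (isCompact_cylBox ℓ).exists_bound_of_continuousOn
    (continuous_slice h.cont hr).continuousOn
  obtain ⟨B, hB⟩ := (isCompact_cylBox ℓ).exists_bound_of_continuousOn
    (continuous_slice h.cont_zz hr).continuousOn
  have key : ∀ (k : ℕ) (m : ℤ), ‖cylMode ℓ k (coreFreq ℓ θ₀ k m) (U r)‖ ≤
      (A * volume.real (cylBox ℓ) + B * volume.real (cylBox ℓ)) /
        (1 + coreFreq ℓ θ₀ k m ^ 2) := fun k m => by
    rw [le_div_iff₀ (by positivity), mul_add, mul_one]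
    refine add_le_add (norm_cylMode_le ℓ k _ hA) ?_
    have h2 := norm_cylMode_le ℓ k (coreFreq ℓ θ₀ k m) hB
    rw [h.cylMode_zz hℓ k m hr, norm_mul, norm_neg, norm_pow, Complex.norm_real, Real.norm_eq_abs,
      sq_abs, mul_comm] at h2
    exact h2
  refine ⟨_, ?_, key⟩
  have := (norm_nonneg _).trans (key 0 0)
  rw [le_div_iff₀ (by positivity), zero_mul] at this
  exact this

/-- The bound `C / (1 + ν²)` alone is not summable over `k`. It is applied at a larger radius `r'`,
and `radialSeries_le` brings it back to `r` with the factor `(tanh r / tanh r')^k`. -/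
theorem summable_norm_cylMode (h : IsCylHarmonic R ℓ θ₀ U Ur Urr Ut Utt Uz Uzz) (hℓ : 0 < ℓ)
    {r : ℝ} (hr : r ∈ Ico 0 R) :
    Summable fun km : ℕ × ℤ => ‖cylMode ℓ km.1 (coreFreq ℓ θ₀ km.1 km.2) (U r)‖ := by
  have hR : 0 < R := hr.1.trans_lt hr.2
  obtain ⟨r', h1, h2⟩ := exists_between hr.2
  have hr' : r' ∈ Ioo 0 R := ⟨hr.1.trans_lt h1, h2⟩
  have ht : Real.tanh r < Real.tanh r' := Real.tanh_strictMono h1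
  have ht0 : 0 ≤ Real.tanh r := by
    have := Real.tanh_strictMono.monotone hr.1
    rwa [Real.tanh_zero] at this
  have hq0 : 0 ≤ Real.tanh r / Real.tanh r' := div_nonneg ht0 (ht0.trans ht.le)
  have hq1 : Real.tanh r / Real.tanh r' < 1 := (div_lt_one (ht0.trans_lt ht)).2 ht
  obtain ⟨C, hC0, hC⟩ := h.exists_norm_cylMode_le hℓ (r := r') ⟨by linarith [hr'.1], h2⟩
  refine Summable.of_nonneg_of_le (fun _ => norm_nonneg _) (fun ⟨k, m⟩ => ?_)
    ((summable_pow_div_one_add_coreFreq_sq hℓ θ₀ hq0 hq1).mul_left C)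
  obtain ⟨α, hα⟩ := h.exists_cylMode_eq hR hℓ k m
  have hC' := hC k m
  have hle := radialSeries_le k (coreFreq ℓ θ₀ k m) ht0 ht.le (ht0.trans_lt ht) (Real.tanh_lt_one r')
  simp only
  rw [hα r' ⟨hr'.1.le, h2⟩] at hC'
  rw [hα r hr]
  rw [norm_mul, Complex.norm_real,
    Real.norm_of_nonneg (radialSeries_nonneg _ _ (ht0.trans ht.le))] at hC'
  rw [norm_mul, Complex.norm_real, Real.norm_of_nonneg (radialSeries_nonneg _ _ ht0)]
  calc ‖α‖ * radialSeries k (coreFreq ℓ θ₀ k m) 0 (Real.tanh r)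
      ≤ ‖α‖ * ((Real.tanh r / Real.tanh r') ^ k *
          radialSeries k (coreFreq ℓ θ₀ k m) 0 (Real.tanh r')) := by gcongr
    _ = (Real.tanh r / Real.tanh r') ^ k *
          (‖α‖ * radialSeries k (coreFreq ℓ θ₀ k m) 0 (Real.tanh r')) := by ring
    _ ≤ (Real.tanh r / Real.tanh r') ^ k * (C / (1 + coreFreq ℓ θ₀ k m ^ 2)) := by gcongr
    _ = _ := by ring

end IsCylHarmonic

/-! ### Fourier expansion on the twisted torus -/

/-- Real form of the Fourier expansion on the twisted torus, when the coefficients are absolutely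
summable. -/
theorem hasSum_cylMode {ℓ θ₀ : ℝ} (hℓ : 0 < ℓ) {V : ℝ × ℝ → ℝ} (hV : Continuous V)
    (hp : ∀ θ z, V (θ + 2 * Real.pi, z) = V (θ, z)) (ht : ∀ θ z, V (θ, z + ℓ) = V (θ + θ₀, z))
    (hs : Summable fun km : ℕ × ℤ =>
      ‖cylMode ℓ km.1 (coreFreq ℓ θ₀ km.1 km.2) (fun x => (V x : ℂ))‖) (θ z : ℝ) :
    HasSum (fun km : ℕ × ℤ => (if km.1 = 0 then 1 else 2) * (((1 / (2 * Real.pi * ℓ) : ℝ) *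
      cylMode ℓ km.1 (coreFreq ℓ θ₀ km.1 km.2) (fun x => (V x : ℂ))) *
        Complex.exp ((tubePhase ℓ θ₀ km.1 km.2 θ z : ℝ) * Complex.I)).re) (V (θ, z)) := by
  have hVc : Continuous fun x => (V x : ℂ) := Complex.continuous_ofReal.comp hV
  set c : ℕ → ℤ → ℂ := fun k m => ((1 / (2 * Real.pi * ℓ) : ℝ) : ℂ) *
      cylMode ℓ k (coreFreq ℓ θ₀ k m) (fun x => (V x : ℂ)) with hc
  have hcs : Summable fun km : ℕ × ℤ => ‖c km.1 km.2‖ := by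
    simp only [hc, norm_mul]
    exact hs.mul_left _
  -- the coefficients in the angle
  set b : ℤ → ℝ → ℂ := fun k z => ((1 / (2 * Real.pi : ℝ) : ℂ)) * ∫ θ in (0 : ℝ)..2 * Real.pi,
    (V (θ, z) : ℂ) * Complex.exp (-(2 * Real.pi * k * θ / (2 * Real.pi) : ℝ) * Complex.I) with hb
  clear_value b c
  have hbcont : ∀ k, Continuous (b k) := by
    intro k
    simp only [hb]
    refine continuous_const.mul
      (intervalIntegral.continuous_parametric_intervalIntegral_of_continuous' ?_ _ _)
    simp only [Function.uncurry_def]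
    fun_prop
  have hbtwist : ∀ (k : ℕ) z, b k (z + ℓ) = b k z * Complex.exp ((k * θ₀ : ℝ) * Complex.I) := by
    intro k z
    set G : ℝ → ℂ := fun θ => (V (θ, z) : ℂ) *
      Complex.exp (-(2 * Real.pi * (k : ℤ) * θ / (2 * Real.pi) : ℝ) * Complex.I) with hG
    have hGp : Function.Periodic G (2 * Real.pi) := by
      intro θ
      simp only [hG, hp]
      congr 1
      refine Complex.exp_eq_exp_iff_exists_int.2 ⟨-k, ?_⟩
      have : (Real.pi : ℂ) ≠ 0 := by exact_mod_cast Real.pi_ne_zero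
      push_cast
      field_simp
      ring
    have hshift : ∀ θ, (V (θ, z + ℓ) : ℂ) *
        Complex.exp (-(2 * Real.pi * (k : ℤ) * θ / (2 * Real.pi) : ℝ) * Complex.I) =
        G (θ + θ₀) * Complex.exp ((k * θ₀ : ℝ) * Complex.I) := by
      intro θ
      simp only [hG]
      rw [ht, mul_assoc (V (θ + θ₀, z) : ℂ), ← Complex.exp_add]
      congr 2
      have : (Real.pi : ℂ) ≠ 0 := by exact_mod_cast Real.pi_ne_zero
      push_cast
      field_simp
      ring
    simp only [hb]
    simp_rw [hshift]
    rw [intervalIntegral.integral_mul_const, intervalIntegral.integral_comp_add_right G, zero_add,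
      add_comm (2 * Real.pi), hGp.intervalIntegral_add_eq θ₀ 0, zero_add, mul_assoc]
  have hbsum : ∀ (k : ℕ) z, HasSum
      (fun m : ℤ => c k m * Complex.exp ((coreFreq ℓ θ₀ k m * z : ℝ) * Complex.I)) (b k z) := by
    intro k z
    -- The translation `z ↦ z + ℓ` multiplies `b k` by `exp (i k θ₀)`; this factor untwists it into
    -- an `ℓ`-periodic function with Fourier coefficients `c k m`.
    set g : ℝ → ℂ := fun z => b k z * Complex.exp (-(k * θ₀ / ℓ * z : ℝ) * Complex.I) with hg
    have hgc : Continuous g := by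
      have := hbcont k
      fun_prop
    have hgp : Function.Periodic g ℓ := by
      intro z
      simp only [hg]
      rw [hbtwist, mul_assoc, ← Complex.exp_add]
      congr 2
      have : (ℓ : ℂ) ≠ 0 := by exact_mod_cast hℓ.ne'
      push_cast
      field_simp
      ring
    have hgcoef : ∀ m : ℤ, (1 / ℓ : ℂ) * ∫ x in (0 : ℝ)..ℓ,
        g x * Complex.exp (-(2 * Real.pi * m * x / ℓ : ℝ) * Complex.I) = c k m := by
      intro m
      have hch := continuous_cylChar k (coreFreq ℓ θ₀ k m)
      simp only [hc, cylMode]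
      rw [setIntegral_cylBox' hℓ (by fun_prop)]
      have hin : ∀ x : ℝ, g x * Complex.exp (-(2 * Real.pi * m * x / ℓ : ℝ) * Complex.I) =
          (1 / (2 * Real.pi : ℝ) : ℂ) * ∫ θ in (0 : ℝ)..2 * Real.pi,
            (V (θ, x) : ℂ) * cylChar k (coreFreq ℓ θ₀ k m) (θ, x) := by
        intro x
        simp only [hg, hb]
        rw [mul_assoc, mul_assoc, ← Complex.exp_add, ← intervalIntegral.integral_mul_const]
        congr 1
        refine intervalIntegral.integral_congr fun θ _ => ?_
        simp only [cylChar]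
        rw [mul_assoc, ← Complex.exp_add]
        congr 2
        have : (Real.pi : ℂ) ≠ 0 := by exact_mod_cast Real.pi_ne_zero
        rw [coreFreq]
        push_cast
        field_simp
        ring
      simp_rw [hin]
      rw [intervalIntegral.integral_const_mul, ← mul_assoc]
      congr 1
      push_cast
      field_simp
    have hck : Summable fun m : ℤ => c k m :=
      Summable.of_norm (hcs.prod_factor k)
    have h := hgp.hasSum_fourier_of_summable hℓ hgc (by simpa only [hgcoef] using hck) z
    simp only [hgcoef] at h
    have h2 := h.mul_right (Complex.exp ((k * θ₀ / ℓ * z : ℝ) * Complex.I))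
    have hz : g z * Complex.exp ((k * θ₀ / ℓ * z : ℝ) * Complex.I) = b k z := by
      simp only [hg]
      rw [mul_assoc, ← Complex.exp_add, neg_mul, neg_add_cancel, Complex.exp_zero, mul_one]
    rw [hz] at h2
    convert! h2 using 2 with m
    rw [mul_assoc, ← Complex.exp_add]
    congr 2
    rw [coreFreq]
    push_cast
    ring
  -- `V` is real, so negative `k` carries no new information; folding it onto `-k` produces the
  -- weight `2` for `k ≥ 1`.
  have hbconj : ∀ (k : ℕ), b (-k) z = (starRingEnd ℂ) (b k z) := by
    intro k
    simp only [hb, map_mul]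
    rw [← intervalIntegral.intervalIntegral_conj]
    congr 1
    · simp [map_ofNat]
    · refine intervalIntegral.integral_congr fun θ _ => ?_
      simp only [map_mul, Complex.conj_ofReal, ← Complex.exp_conj, map_neg, Complex.conj_I]
      congr 2
      push_cast
      ring
  have hbsummable : Summable fun k : ℕ => b k z := by
    have h1 : Summable fun k : ℕ => ∑' m, ‖c k m‖ := hcs.prod
    refine Summable.of_norm_bounded h1 fun k => ?_
    rw [← (hbsum k z).tsum_eq]
    have hck : Summable fun m : ℤ => ‖c k m‖ := hcs.prod_factor k
    refine tsum_of_norm_bounded hck.hasSum fun m => ?_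
    rw [norm_mul, Complex.norm_exp_ofReal_mul_I, mul_one]
  have hbsummable' : Summable fun k : ℤ => b k z := by
    refine Summable.of_nat_of_neg hbsummable ?_
    refine Summable.of_norm ?_
    simp only [hbconj, RCLike.norm_conj]
    exact hbsummable.norm
  have hθ : HasSum (fun k : ℤ => b k z *
      Complex.exp ((2 * Real.pi * k * θ / (2 * Real.pi) : ℝ) * Complex.I)) (V (θ, z) : ℂ) := by
    have hp' : Function.Periodic (fun θ => (V (θ, z) : ℂ)) (2 * Real.pi) := fun θ => by
      simp only [hp]
    simp only [hb] at hbsummable' ⊢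
    exact hp'.hasSum_fourier_of_summable Real.two_pi_pos (by fun_prop) hbsummable' θ
  have hfold : HasSum (fun k : ℕ => (if k = 0 then 1 else 2) *
      (b k z * Complex.exp ((k * θ : ℝ) * Complex.I)).re) (V (θ, z)) := by
    -- Pairing `k` with `-k` counts `k = 0` twice; the subtracted term corrects this.
    have h1 := (Complex.hasSum_re hθ.nat_add_neg).sub (hasSum_ite_eq (0 : ℕ) (b 0 z).re)
    have hexp : ∀ k : ℤ, ((2 * Real.pi * k * θ / (2 * Real.pi) : ℝ) : ℂ) = (k * θ : ℝ) := by
      intro k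
      rw [mul_assoc, mul_div_cancel_left₀ _ Real.two_pi_pos.ne']
    simp only [hexp] at h1
    have hval : ((V (θ, z) : ℂ) + b 0 z * Complex.exp (((0 : ℤ) * θ : ℝ) * Complex.I)).re -
        (b 0 z).re = V (θ, z) := by simp
    rw [hval] at h1
    convert! h1 using 2 with k
    have hcc : b (-k) z * Complex.exp (((-k : ℤ) * θ : ℝ) * Complex.I) =
        (starRingEnd ℂ) (b k z * Complex.exp (((k : ℤ) * θ : ℝ) * Complex.I)) := by
      rw [hbconj, map_mul, ← Complex.exp_conj, map_mul, Complex.conj_I, Complex.conj_ofReal]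
      congr 2
      push_cast
      ring
    rw [hcc, Complex.add_re, Complex.conj_re]
    rcases eq_or_ne k 0 with rfl | hk
    · simp
    · rw [if_neg hk, if_neg hk, sub_zero, two_mul, Int.cast_natCast]
  have hterm : ∀ km : ℕ × ℤ, c km.1 km.2 *
      Complex.exp ((tubePhase ℓ θ₀ km.1 km.2 θ z : ℝ) * Complex.I) =
      c km.1 km.2 * Complex.exp ((coreFreq ℓ θ₀ km.1 km.2 * z : ℝ) * Complex.I) *
        Complex.exp ((km.1 * θ : ℝ) * Complex.I) := by
    intro km
    rw [mul_assoc, ← Complex.exp_add]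
    congr 2
    rw [coreFreq, tubePhase]
    push_cast
    ring
  have hall : Summable (fun km : ℕ × ℤ => (if km.1 = 0 then 1 else 2) * (c km.1 km.2 *
      Complex.exp ((tubePhase ℓ θ₀ km.1 km.2 θ z : ℝ) * Complex.I)).re) := by
    refine Summable.of_norm_bounded (hcs.mul_left 2) fun km => ?_
    rw [norm_mul]
    have h1 : ‖(if km.1 = 0 then 1 else 2 : ℝ)‖ ≤ 2 := by split_ifs <;> norm_num
    have h2 : ‖(c km.1 km.2 *
        Complex.exp ((tubePhase ℓ θ₀ km.1 km.2 θ z : ℝ) * Complex.I)).re‖ ≤ ‖c km.1 km.2‖ := by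
      refine (Complex.abs_re_le_norm _).trans ?_
      rw [norm_mul, Complex.norm_exp_ofReal_mul_I, mul_one]
    gcongr
  -- Absolute summability lets the double sum be evaluated iteratively, over `m` inside and `k`
  -- outside, which identifies its value.
  have hfib := hall.hasSum.prod_fiberwise (g := fun k : ℕ => (if k = 0 then 1 else 2) *
      (b k z * Complex.exp ((k * θ : ℝ) * Complex.I)).re) fun k => by
    have hterm' := fun m => hterm (k, m)
    simp only at hterm'
    simp only [hterm']
    exact (Complex.hasSum_re ((hbsum k z).mul_right _)).mul_left _
  rw [← hfib.unique hfold]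
  simpa only [hc] using hall.hasSum

/-! ### The expansion theorem -/

/-- Every harmonic function on a tube has a series expansion in the separated solutions,
which converges absolutely and locally uniformly. -/
theorem mainTheorem11 (R ℓ θ₀ : ℝ) (hR : 0 < R) (hℓ : 0 < ℓ)
    (f : MargulisTube R ℓ θ₀ → ℝ) (hf : IsHarmonicOnTube f) :
    ∃ a a' : ℕ → ℤ → ℝ,
      HasSumLocallyUniformly
        (fun (km : ℕ × ℤ) (q : Set.Ico (0 : ℝ) R × ℝ × ℝ) =>
          radialTerm ℓ θ₀ km.1 km.2 q.1 *
            ((a km.1 km.2 * Real.sin (tubePhase ℓ θ₀ km.1 km.2 q.2.1 q.2.2) +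
              a' km.1 km.2 * Real.cos (tubePhase ℓ θ₀ km.1 km.2 q.2.1 q.2.2) : ℝ) : ℂ))
        (fun q => ((f (tubePoint ℓ θ₀ q) : ℝ) : ℂ)) := by
  obtain ⟨Ur, Urr, Ut, Utt, Uz, Uzz, h⟩ := hf.exists_isCylHarmonic
  choose α hα using fun k m => h.exists_cylMode_eq hR hℓ k m
  have hmem : ∀ r ∈ Ico 0 R, r ∈ Ioo (-R) R := fun r hr => ⟨by linarith [hr.1], hr.2⟩
  have htanh : ∀ r ∈ Ico 0 R, 0 ≤ Real.tanh r := fun r hr => by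
    have := Real.tanh_strictMono.monotone hr.1
    rwa [Real.tanh_zero] at this
  -- The folding weight times the inverse area of the torus. The coefficients in `F` come from `Re
  -- (α exp (iφ)) = Re α cos φ - Im α sin φ`.
  set w : ℕ → ℝ := fun k => (if k = 0 then 1 else 2) * (1 / (2 * Real.pi * ℓ)) with hw
  set F := fun (km : ℕ × ℤ) (q : Set.Ico (0 : ℝ) R × ℝ × ℝ) =>
    radialTerm ℓ θ₀ km.1 km.2 q.1 *
      ((-(w km.1 * (α km.1 km.2).im) * Real.sin (tubePhase ℓ θ₀ km.1 km.2 q.2.1 q.2.2) +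
        w km.1 * (α km.1 km.2).re * Real.cos (tubePhase ℓ θ₀ km.1 km.2 q.2.1 q.2.2) : ℝ) : ℂ)
    with hF
  have hFre : ∀ km q, F km q = ((if km.1 = 0 then 1 else 2) * (((1 / (2 * Real.pi * ℓ) : ℝ) *
      cylMode ℓ km.1 (coreFreq ℓ θ₀ km.1 km.2)
        (fun x => (tubeLift f (cylPoint q.1 x.1 x.2) : ℂ))) *
        Complex.exp ((tubePhase ℓ θ₀ km.1 km.2 q.2.1 q.2.2 : ℝ) * Complex.I)).re : ℝ) := by
    intro km q
    rw [hα km.1 km.2 q.1 q.1.2]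
    simp only [hF, hw, radialTerm_eq]
    rw [← Complex.ofReal_mul, Complex.ofReal_inj]
    simp only [Complex.mul_re, Complex.mul_im, Complex.ofReal_re, Complex.ofReal_im,
      Complex.exp_ofReal_mul_I_re, Complex.exp_ofReal_mul_I_im]
    ring
  have hpt : ∀ q, HasSum (fun km => F km q) ((f (tubePoint ℓ θ₀ q) : ℝ) : ℂ) := by
    intro q
    have hr := hmem q.1 q.1.2
    have hcont : Continuous fun x : ℝ × ℝ => tubeLift f (cylPoint q.1 x.1 x.2) := by
      have := IsCylHarmonic.continuous_slice h.cont hr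
      exact Complex.continuous_re.comp this
    have h1 := hasSum_cylMode (θ₀ := θ₀) hℓ hcont
      (fun θ z => by exact_mod_cast h.periodic q.1 hr θ z)
      (fun θ z => by exact_mod_cast h.twist q.1 hr θ z)
      (h.summable_norm_cylMode hℓ q.1.2) q.2.1 q.2.2
    have h2 : tubeLift f (cylPoint q.1 q.2.1 q.2.2) = f (tubePoint ℓ θ₀ q) :=
      dif_pos (cylPoint_mem_tubeCover q.1.2.1 q.1.2.2 q.2.1 q.2.2)
    rw [← h2]
    simp only [hFre]
    exact Complex.hasSum_ofReal.2 h1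
  refine ⟨fun k m => -(w k * (α k m).im), fun k m => w k * (α k m).re,
    hasSumLocallyUniformly_of_of_forall_exists_nhds fun q₀ => ?_⟩
  obtain ⟨r₁, h1, h2⟩ := exists_between q₀.1.2.2
  have hr₁ : r₁ ∈ Ico 0 R := ⟨q₀.1.2.1.trans h1.le, h2⟩
  -- On this neighbourhood `|c(r)| = |α| Φ(tanh r)` is at most its value at `r₁`, and `θ`, `z` enter
  -- only through a factor of modulus one; the summable modes at `r₁` are thus a Weierstrass
  -- majorant.
  refine ⟨{q | (q.1 : ℝ) < r₁}, (isOpen_lt (by fun_prop) continuous_const).mem_nhds h1, ?_⟩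
  rw [hasSumUniformlyOn_iff_tendstoUniformlyOn]
  have hM := tendstoUniformlyOn_tsum (f := F) (s := {q | (q.1 : ℝ) < r₁})
    ((h.summable_norm_cylMode hℓ hr₁).mul_left (2 * (1 / (2 * Real.pi * ℓ)))) fun km q hq => ?_
  · have : (fun q => ((f (tubePoint ℓ θ₀ q) : ℝ) : ℂ)) = fun q => ∑' km, F km q :=
      funext fun q => (hpt q).tsum_eq.symm
    rw [this]
    simpa only [Finset.sum_fn] using hM
  · have hq' : (q.1 : ℝ) < r₁ := hq
    have hle : ‖((if km.1 = 0 then 1 else 2 : ℝ))‖ ≤ 2 := by split_ifs <;> norm_num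
    have hΦ := radialSeries_nonneg km.1 (coreFreq ℓ θ₀ km.1 km.2) (htanh q.1 q.1.2)
    have hlt : Real.tanh q.1 < Real.tanh r₁ := Real.tanh_strictMono hq'
    have hpos : 0 < Real.tanh r₁ := (htanh q.1 q.1.2).trans_lt hlt
    have hmono : radialSeries km.1 (coreFreq ℓ θ₀ km.1 km.2) 0 (Real.tanh q.1) ≤
        radialSeries km.1 (coreFreq ℓ θ₀ km.1 km.2) 0 (Real.tanh r₁) :=
      (radialSeries_le _ _ (htanh q.1 q.1.2) hlt.le hpos (Real.tanh_lt_one _)).trans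
        (mul_le_of_le_one_left (radialSeries_nonneg _ _ hpos.le) (pow_le_one₀
          (div_nonneg (htanh q.1 q.1.2) hpos.le) ((div_le_one hpos).2 hlt.le)))
    have hmode : ‖cylMode ℓ km.1 (coreFreq ℓ θ₀ km.1 km.2)
        (fun x => (tubeLift f (cylPoint q.1 x.1 x.2) : ℂ))‖ ≤
        ‖cylMode ℓ km.1 (coreFreq ℓ θ₀ km.1 km.2)
          (fun x => (tubeLift f (cylPoint r₁ x.1 x.2) : ℂ))‖ := by
      rw [hα km.1 km.2 q.1 q.1.2, hα km.1 km.2 r₁ hr₁, norm_mul, norm_mul, Complex.norm_real,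
        Complex.norm_real, Real.norm_of_nonneg hΦ, Real.norm_of_nonneg (hΦ.trans hmono)]
      gcongr
    rw [hFre, Complex.norm_real, norm_mul]
    have hre := Complex.abs_re_le_norm (((1 / (2 * Real.pi * ℓ) : ℝ) *
      cylMode ℓ km.1 (coreFreq ℓ θ₀ km.1 km.2)
        (fun x => (tubeLift f (cylPoint q.1 x.1 x.2) : ℂ))) *
        Complex.exp ((tubePhase ℓ θ₀ km.1 km.2 q.2.1 q.2.2 : ℝ) * Complex.I))
    rw [norm_mul, Complex.norm_exp_ofReal_mul_I, mul_one, norm_mul, Complex.norm_real,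
      Real.norm_of_nonneg (by positivity), ← Real.norm_eq_abs] at hre
    rw [mul_assoc (2 : ℝ) (1 / (2 * Real.pi * ℓ))]
    refine mul_le_mul hle (hre.trans ?_) (norm_nonneg _) zero_le_two
    gcongr
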